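/- Let $\mathcal H$ be a finite-dimensional Hilbert space with $\dim\mathcal H\ge 2$, let $t,\varepsilon\in(0,1)$, and let $\rho_1,\rho_2$ be density matrices on $\mathcal H$. All logarithms are to base $2$. For $j=1,2$ put $S_j=-\operatorname{tr}(\rho_j\log\rho_j)$ and $\sigma_j=\sqrt{\operatorname{tr}(\rho_j(\log\rho_j)^2)-S_j^2}$. Let $\Phi$ be the distribution function of the standard normal distribution and $\Phi^{-1}(x)=\sup\{z\in\mathbb R:\Phi(z)\le x\}$. Let $\{q^{(j)}_i,|\varphi^{(j)}_i\rangle\}_i$, $j=1,2$, be ensembles of pure states in $\mathcal H$ with $\rho_j=\sum_i q^{(j)}_i|\varphi^{(j)}_i\rangle\langle\varphi^{(j)}_i|$. For $n\ge1$ uses, the mixed source $\rho=(\rho_1,\rho_2,t)$ has the ensemble $\mathfrak E^{(n)}$ whose indices are the pairs $(j,\underline i)$ with $j\in\{1,2\}$ and $\underline i=i_1\cdots i_n$; the index $(j,\underline i)$ has probability $t_j\,q^{(j)}_{i_1}\cdots q^{(j)}_{i_n}$, where $t_1=t$ and $t_2=1-t$, and signal $|\varphi^{(j)}_{i_1}\rangle\otimes\cdots\otimes|\varphi^{(j)}_{i_n}\rangle\in\mathcal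 H^{\otimes n}$ (its average state is $t\rho_1^{\otimes n}+(1-t)\rho_2^{\otimes n}$). A visible code $\mathcal C=(\mathcal V,\mathfrak D,M)$ for an ensemble $\{p_i,|\psi_i\rangle\}_i$ in a space $\mathcal K$ consists of an integer $M<\dim\mathcal K$, an arbitrary map $\mathcal V$ from the indices to the density matrices on $\mathbb C^M$, and a completely positive trace-preserving map $\mathfrak D$ from operators on $\mathbb C^M$ to operators on $\mathcal K$; its ensemble average fidelity is $\bar F=\sum_i p_i\langle\psi_i|\mathfrak D(\mathcal V(i))|\psi_i\rangle$. A number $r\in\mathbb R$ is $(R,\varepsilon)$-achievable if there are codes $\mathcal C_n=(\mathcal V_n,\mathfrak D_n,M_n)$ for $\mathfrak E^{(n)}$, $n\ge 1$, with $$\liminf_{n\to\infty}\bar F(\mathfrak E^{(n)},\mathcal C_n)\ge1-\varepsilon\quad\text{and}\quad\limsup_{n\to\infty}\frac{\log M_n-nR}{\sqrt n}\le r,$$ and the second order asymptotic rate $b(R,\varepsilon|\rho)\in[-\infty,\infty]$ is the infimum of all $(R,\varepsilon)$-achievable $r$. Then: (i) If $S_1=S_2=S$, then $b(S,\varepsilon|\rho)=L$,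 where $L\in\mathbb R$ is the solution of $$t\,\Phi\!\left(\frac{L}{\sigma_1}\right)+(1-t)\,\Phi\!\left(\frac{L}{\sigma_2}\right)=1-\varepsilon,$$ which exists and is unique when $\sigma_1,\sigma_2>0$. If some $\sigma_j$ is $0$, read $\Phi(x/\sigma_j)$ as $0$ for $x<0$ and as $1$ for $x\ge0$, and the solution as the unique point $L$ such that the left-hand side, as a function of $x$ in place of $L$, is less than $1-\varepsilon$ for all $x<L$ and greater than $1-\varepsilon$ for all $x>L$. (ii) If $S_1>S_2$ and $t>\varepsilon$, then $b(S_1,\varepsilon|\rho)=-\sigma_1\,\Phi^{-1}\!\left(\dfrac{\varepsilon}{t}\right)$. (iii) If $S_1>S_2$ and $t<\varepsilon$, then $b(S_2,\varepsilon|\rho)=-\sigma_2\,\Phi^{-1}\!\left(\dfrac{\varepsilon-t}{1-t}\right)$. -/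

import Mathlib

namespace MixedSource

noncomputable section

open Matrix Filter

/-! ### States, entropy and information variance -/

open scoped ComplexOrder in
/-- Density matrices on the finite-dimensional Hilbert space `ℂ^d`. -/
def IsState {d : Type*} [Fintype d] (ρ : Matrix d d ℂ) : Prop :=
  ρ.PosSemidef ∧ ρ.trace = 1

/-- The logarithm to base 2 of a Hermitian matrix, through the functional calculus
(`Real.logb 2 0 = 0`, so eigenvalue zero contributes `0` to the traces below). -/
def matLog {d : Type*} [Fintype d] [DecidableEq d] (ρ : Matrix d d ℂ) : Matrix d d ℂ :=
  cfc (Real.logb 2) ρ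

/-- The von Neumann entropy `S(ρ) = -tr (ρ log ρ)`. -/
def entropy {d : Type*} [Fintype d] [DecidableEq d] (ρ : Matrix d d ℂ) : ℝ :=
  -(ρ * matLog ρ).trace.re

/-- The quantum information variance
`V(ρ‖1) = tr (ρ (log ρ)²) - D(ρ‖1)²`, where `D(ρ‖1) = tr (ρ log ρ)`. -/
def infoVariance {d : Type*} [Fintype d] [DecidableEq d] (ρ : Matrix d d ℂ) : ℝ :=
  (ρ * (matLog ρ) ^ 2).trace.re - ((ρ * matLog ρ).trace.re) ^ 2

/-- `σ(ρ) = √V(ρ‖1)`. -/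
def sigma {d : Type*} [Fintype d] [DecidableEq d] (ρ : Matrix d d ℂ) : ℝ :=
  Real.sqrt (infoVariance ρ)

/-! ### The normal distribution -/

/-- The cumulative distribution function of a standard normal random variable. -/
def Phi (x : ℝ) : ℝ := ProbabilityTheory.cdf (ProbabilityTheory.gaussianReal 0 1) x

/-- `Φ⁻¹(ε) = sup {z | Φ(z) ≤ ε}`. -/
def PhiInv (ε : ℝ) : ℝ := sSup {z : ℝ | Phi z ≤ ε}

/-- `Φ(x / σ)` for `σ > 0`; for `σ = 0` it is the distribution function of the constant `0`, that is
the limit of `Φ(x / s)` as `s ↓ 0` for `x ≠ 0`. -/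
def scaledPhi (σ x : ℝ) : ℝ :=
  if σ = 0 then (if x < 0 then 0 else 1) else Phi (x / σ)

/-! ### Ensembles of pure states -/

/-- An ensemble `{p_i, |ψ_i⟩}_i` of unit vectors of `ℂ^d`, with a discrete (finite or infinite)
index set `ι`. -/
structure PureEnsemble (ι : Type*) (d : Type*) [Fintype d] where
  prob : ι → ℝ
  prob_nonneg : ∀ i, 0 ≤ prob i
  prob_hasSum : HasSum prob 1
  signal : ι → d → ℂ
  signal_unit : ∀ i, star (signal i) ⬝ᵥ signal i = 1

namespace PureEnsemble

/-- The projector `ψ_i = |ψ_i⟩⟨ψ_i|`. -/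
def proj {ι d : Type*} [Fintype d] (E : PureEnsemble ι d) (i : ι) : Matrix d d ℂ :=
  vecMulVec (E.signal i) (star (E.signal i))

/-- `ρ = ∑_i p_i ψ_i` is the source state (ensemble average) of the ensemble. -/
def HasSourceState {ι d : Type*} [Fintype d] (E : PureEnsemble ι d) (ρ : Matrix d d ℂ) : Prop :=
  HasSum (fun i => (E.prob i : ℂ) • E.proj i) ρ

theorem hasSum_prod {ι : Type*} {q : ι → ℝ} (h0 : ∀ i, 0 ≤ q i) (h1 : HasSum q 1) (n : ℕ) :
    HasSum (fun i : Fin n → ι => ∏ k, q (i k)) 1 := by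
  induction n with
  | zero =>
    have h := hasSum_unique (fun i : Fin 0 → ι => ∏ k, q (i k))
    rwa [Fin.prod_univ_zero] at h
  | succ n ih =>
    have hs : Summable fun x : ι × (Fin n → ι) => q x.1 * ∏ k, q (x.2 k) :=
      h1.summable.mul_of_nonneg (g := fun i : Fin n → ι => ∏ k, q (i k)) ih.summable h0
        (fun i => Finset.prod_nonneg fun k _ => h0 (i k))
    have h := h1.mul ih hs
    rw [one_mul] at h
    rw [← (Fin.consEquiv fun _ : Fin (n + 1) => ι).hasSum_iff]
    refine h.congr_fun ?_
    intro x
    simp [Fin.prod_univ_succ, Fin.consEquiv]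

/-- The ensemble for `n` uses of a memoryless source: probabilities
`p_{i_1} ⋯ p_{i_n}` and signals `|ψ_{i_1}⟩ ⊗ ⋯ ⊗ |ψ_{i_n}⟩` in `(ℂ^d)^{⊗n} = ℂ^(Fin n → d)`. -/
def power {ι d : Type*} [Fintype d] (E : PureEnsemble ι d) (n : ℕ) :
    PureEnsemble (Fin n → ι) (Fin n → d) where
  prob i := ∏ k, E.prob (i k)
  prob_nonneg i := Finset.prod_nonneg fun k _ => E.prob_nonneg _
  prob_hasSum := hasSum_prod E.prob_nonneg E.prob_hasSum n
  signal i x := ∏ k, E.signal (i k) (x k)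
  signal_unit i := by
    classical
    have h : ∀ k, ∑ x, star (E.signal (i k) x) * E.signal (i k) x = 1 := fun k =>
      E.signal_unit (i k)
    simp only [dotProduct, Pi.star_apply, star_prod, ← Finset.prod_mul_distrib]
    rw [← Fintype.piFinset_univ, ← Finset.prod_univ_sum (fun _ => Finset.univ)
      (fun k x => star (E.signal (i k) x) * E.signal (i k) x)]
    exact Finset.prod_eq_one fun k _ => h k

/-- The mixture of two ensembles on the same space, with weights `t` and `1 - t`. Its index set is
the disjoint union of the two index sets. -/
def mix {ι₁ ι₂ d : Type*} [Fintype d] (t : ℝ) (ht : t ∈ Set.Ioo (0 : ℝ) 1)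
    (E₁ : PureEnsemble ι₁ d) (E₂ : PureEnsemble ι₂ d) : PureEnsemble (ι₁ ⊕ ι₂) d where
  prob := Sum.elim (fun i => t * E₁.prob i) (fun i => (1 - t) * E₂.prob i)
  prob_nonneg := by
    rintro (i | i)
    · exact mul_nonneg ht.1.le (E₁.prob_nonneg i)
    · exact mul_nonneg (sub_nonneg.2 ht.2.le) (E₂.prob_nonneg i)
  prob_hasSum := by
    have h := HasSum.sum
      (f := Sum.elim (fun i => t * E₁.prob i) (fun i => (1 - t) * E₂.prob i))
      (E₁.prob_hasSum.mul_left t) (E₂.prob_hasSum.mul_left (1 - t))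
    simpa using h
  signal := Sum.elim E₁.signal E₂.signal
  signal_unit := by
    rintro (i | i)
    · exact E₁.signal_unit i
    · exact E₂.signal_unit i

end PureEnsemble

/-! ### Visible source coding -/

section Codes

open scoped ComplexOrder MatrixOrder Matrix.Norms.L2Operator CStarAlgebra

/-- A code for fixed-length visible source coding of signals in `ℂ^d` with index set `ι`: an
arbitrary map from the indices to states of the compressed space `ℂ^M`, where `M < dim ℂ^d`, and a
decoder, which is a completely positive trace-preserving map. -/
structure VisibleCode (ι : Type*) (d : Type*) [Fintype d] [DecidableEq d] where
  M : ℕ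
  M_lt : M < Fintype.card d
  enc : ι → Matrix (Fin M) (Fin M) ℂ
  enc_isState : ∀ i, IsState (enc i)
  dec : Matrix (Fin M) (Fin M) ℂ →CP Matrix d d ℂ
  dec_trace : ∀ X, (dec X).trace = X.trace

/-- The ensemble average fidelity `∑_i p_i tr (𝔇(𝒱(i)) ψ_i)`. -/
def avgFidelity {ι d : Type*} [Fintype d] [DecidableEq d] (E : PureEnsemble ι d)
    (C : VisibleCode ι d) : ℝ :=
  ∑' i, E.prob i * ((C.dec (C.enc i)) * E.proj i).trace.re

end Codes

/-- `r` is an `(R, ε)`-achievable rate for the mixture, with weights `t` and `1 - t`, of the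
memoryless sources with ensembles `E₁` and `E₂`. The limits are taken in the extended reals. -/
def IsAchievableRate {ι₁ ι₂ d : Type*} [Fintype d] [DecidableEq d]
    (t : ℝ) (ht : t ∈ Set.Ioo (0 : ℝ) 1) (E₁ : PureEnsemble ι₁ d) (E₂ : PureEnsemble ι₂ d)
    (R ε r : ℝ) : Prop :=
  ∃ C : (n : ℕ+) → VisibleCode ((Fin n → ι₁) ⊕ (Fin n → ι₂)) (Fin n → d),
    ((1 - ε : ℝ) : EReal) ≤
      liminf (fun n : ℕ+ =>
        ((avgFidelity (PureEnsemble.mix t ht (E₁.power n) (E₂.power n)) (C n) : ℝ) : EReal)) atTop ∧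
    limsup (fun n : ℕ+ =>
        (((Real.logb 2 (C n).M - (n : ℕ) * R) / Real.sqrt (n : ℕ) : ℝ) : EReal)) atTop ≤ (r : EReal)

/-- The second order asymptotic rate `b(R, ε|ρ)`: the infimum, in the extended reals, over all
`(R, ε)`-achievable rates. -/
def secondOrderRate {ι₁ ι₂ d : Type*} [Fintype d] [DecidableEq d]
    (t : ℝ) (ht : t ∈ Set.Ioo (0 : ℝ) 1) (E₁ : PureEnsemble ι₁ d) (E₂ : PureEnsemble ι₂ d)
    (R ε : ℝ) : EReal :=
  ⨅ r ∈ {r : ℝ | IsAchievableRate t ht E₁ E₂ R ε r}, (r : EReal)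

end

end MixedSource

/-!
The encoder of a visible code sees the index of the signal, so the fidelity of a code splits as
`t F₁ + (1 - t) F₂` over the two sources, and everything is decided by the spectra of the tensor
powers of `ρ₁` and `ρ₂`. Let `tailMass p n s` be the total weight of the eigenvalues `≥ s` of
`ρ^{⊗n}`, where `p` is the spectrum of `ρ`.

*Converse.* Let `P` be the spectral projection of the source state onto eigenvalues `≥ s`,
`Q = 1 - P`, and let `σ` be an output of the decoder of a code of dimension `M`. For all `c > 0`,
`σ ≤ (1 + c) P σ P + (1 + c⁻¹) Q σ Q`. Here `P σ P ≤ P`, while `Q σ Q ≤ Q W Q` with `W` the image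
of the identity under the decoder, an operator of trace `M` which does not depend on the signal.
Averaging over the signals bounds the fidelity by `(1 + c) tail + (1 + c⁻¹) s M` (`avgFidelity_le`).

*Direct part.* At most `1 / s` eigenvalues are `≥ s`. An isometry onto the span of the
corresponding eigenvectors of both components gives a code of dimension at most `2 / s + 1` whose
fidelity is at least the mixture of the two tails (`exists_code`).

*Asymptotics.* For `s = 2 ^ (-(n R + √n x))` the tail is the probability that the sum of `n`
independent copies of the information content `- log p` is at most `n R + √n x`. By the central
limit theorem it converges to `Φ (x / σ)` for `R = S` (`tendsto_tailMass`), hence to `1` for `R > S`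
and to `0` for `R < S`. The converse and the direct part then identify the second order rate as the
point where `t g₁ + (1 - t) g₂` crosses `1 - ε`, where `gⱼ` are the limiting tails
(`secondOrderRate_eq`).
-/

namespace MixedSource

noncomputable section

open Matrix Filter
open scoped ComplexOrder

/-! ### Positive semidefinite matrices -/

section LinearAlgebra

variable {D : Type*} [Fintype D]

lemma trace_mul_re_nonneg {A B : Matrix D D ℂ} (hA : A.PosSemidef) (hB : B.PosSemidef) :
    0 ≤ (A * B).trace.re := by
  classical
  obtain ⟨C, rfl⟩ : ∃ C : Matrix D D ℂ, B = Cᴴ * C := by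
    open scoped MatrixOrder Matrix.Norms.L2Operator in
    obtain ⟨C, hC⟩ := CStarAlgebra.nonneg_iff_eq_star_mul_self.mp (nonneg_iff_posSemidef.mpr hB)
    exact ⟨C, hC⟩
  rw [← Matrix.mul_assoc, trace_mul_comm, ← Matrix.mul_assoc]
  exact (Complex.le_def.mp (hA.mul_mul_conjTranspose_same C).trace_nonneg).1

lemma trace_mul_re_le {A A' B : Matrix D D ℂ} (h : (A' - A).PosSemidef) (hB : B.PosSemidef) :
    (A * B).trace.re ≤ (A' * B).trace.re := by
  have := trace_mul_re_nonneg h hB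
  rw [Matrix.sub_mul, trace_sub, Complex.sub_re] at this
  linarith

/-- The matrix with eigenvalues `f a` and eigenvectors the columns of `U`. -/
def spectralMatrix [DecidableEq D] (U : Matrix D D ℂ) (f : D → ℝ) : Matrix D D ℂ :=
  U * diagonal (fun a => (f a : ℂ)) * Uᴴ

section SpectralMatrix

variable [DecidableEq D] {U : Matrix D D ℂ} {f g : D → ℝ}

lemma spectralMatrix_mul (hU : Uᴴ * U = 1) :
    spectralMatrix U f * spectralMatrix U g = spectralMatrix U (fun a => f a * g a) := by
  unfold spectralMatrix
  calc U * diagonal (fun a => (f a : ℂ)) * Uᴴ * (U * diagonal (fun a => (g a : ℂ)) * Uᴴ)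
      = U * diagonal (fun a => (f a : ℂ)) * (Uᴴ * U) * diagonal (fun a => (g a : ℂ)) * Uᴴ := by
        simp only [Matrix.mul_assoc]
    _ = _ := by
        rw [hU, Matrix.mul_one, Matrix.mul_assoc U, diagonal_mul_diagonal]
        push_cast
        rfl

lemma spectralMatrix_sub :
    spectralMatrix U f - spectralMatrix U g = spectralMatrix U (fun a => f a - g a) := by
  unfold spectralMatrix
  rw [← Matrix.sub_mul, ← Matrix.mul_sub, diagonal_sub]
  push_cast
  rfl

lemma spectralMatrix_const (hU : Uᴴ * U = 1) (x : ℝ) :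
    spectralMatrix U (fun _ => x) = (x : ℂ) • (1 : Matrix D D ℂ) := by
  unfold spectralMatrix
  rw [← smul_one_eq_diagonal, Matrix.mul_smul, Matrix.smul_mul, Matrix.mul_one,
    mul_eq_one_comm.mp hU]

lemma spectralMatrix_trace (hU : Uᴴ * U = 1) : (spectralMatrix U f).trace.re = ∑ a, f a := by
  unfold spectralMatrix
  rw [trace_mul_comm, ← Matrix.mul_assoc, hU, Matrix.one_mul, trace_diagonal, Complex.re_sum]
  simp

lemma spectralMatrix_posSemidef (hf : ∀ a, 0 ≤ f a) : (spectralMatrix U f).PosSemidef :=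
  PosSemidef.mul_mul_conjTranspose_same
    (posSemidef_diagonal_iff.mpr fun a => by exact_mod_cast hf a) U

lemma spectralMatrix_isHermitian : (spectralMatrix U f).IsHermitian :=
  isHermitian_mul_mul_conjTranspose U <| isHermitian_diagonal_of_self_adjoint _ <| by
    ext a; simp

end SpectralMatrix

/-- The spectral theorem, simultaneously for a Hermitian matrix and its logarithm. -/
lemma exists_spectralMatrix [DecidableEq D] {A : Matrix D D ℂ} (hA : A.IsHermitian) :
    ∃ U : Matrix D D ℂ, Uᴴ * U = 1 ∧ A = spectralMatrix U hA.eigenvalues ∧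
      matLog A = spectralMatrix U (fun a => Real.logb 2 (hA.eigenvalues a)) := by
  refine ⟨hA.eigenvectorUnitary.1, mem_unitaryGroup_iff'.mp hA.eigenvectorUnitary.2, ?_, ?_⟩
  · conv_lhs => rw [hA.spectral_theorem, Unitary.conjStarAlgAut_apply]
    rfl
  · rw [matLog, hA.cfc_eq, IsHermitian.cfc, Unitary.conjStarAlgAut_apply]
    rfl

/-- A positive semidefinite matrix is at most its trace times the identity. -/
lemma posSemidef_trace_smul_one_sub [DecidableEq D] {A : Matrix D D ℂ} (hA : A.PosSemidef) :
    (A.trace • (1 : Matrix D D ℂ) - A).PosSemidef := by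
  obtain ⟨U, hU, h, -⟩ := exists_spectralMatrix hA.1
  have hle : ∀ a, hA.1.eigenvalues a ≤ ∑ b, hA.1.eigenvalues b := fun a =>
    Finset.single_le_sum (fun b _ => hA.eigenvalues_nonneg b) (Finset.mem_univ a)
  have ht : A.trace = ((∑ b, hA.1.eigenvalues b : ℝ) : ℂ) := by
    rw [hA.1.trace_eq_sum_eigenvalues]; push_cast; rfl
  rw [ht]
  generalize hA.1.eigenvalues = q at h hle
  rw [← spectralMatrix_const hU, h, spectralMatrix_sub]
  exact spectralMatrix_posSemidef fun a => sub_nonneg.mpr (hle a)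

lemma IsState.one_sub_posSemidef [DecidableEq D] {ρ : Matrix D D ℂ} (h : IsState ρ) :
    (1 - ρ).PosSemidef := by
  simpa [h.2] using posSemidef_trace_smul_one_sub h.1

/-- The operator inequality `σ ≤ (1 + c) P σ P + (1 + c⁻¹) Q σ Q` with `Q = 1 - P`: the difference
of the two sides is `c (P - c⁻¹ Q) σ (P - c⁻¹ Q)`. -/
lemma pinching_posSemidef [DecidableEq D] {σ P : Matrix D D ℂ} (hσ : σ.PosSemidef)
    (hP : P.IsHermitian) {c : ℝ} (hc : 0 < c) :
    (((1 + c : ℝ) : ℂ) • (P * σ * P) + ((1 + c⁻¹ : ℝ) : ℂ) • ((1 - P) * σ * (1 - P))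
      - σ).PosSemidef := by
  have h := (hσ.mul_mul_conjTranspose_same (P - ((c⁻¹ : ℝ) : ℂ) • (1 - P))).smul
    (a := ((c : ℝ) : ℂ)) (by exact_mod_cast hc.le)
  convert h using 1
  have hc' : (c : ℂ) ≠ 0 := by exact_mod_cast hc.ne'
  rw [conjTranspose_sub, conjTranspose_smul, conjTranspose_sub, hP.eq, conjTranspose_one]
  simp only [Complex.star_def, Complex.conj_ofReal, Matrix.sub_mul, Matrix.mul_sub,
    Matrix.smul_mul, Matrix.mul_smul, Matrix.one_mul, Matrix.mul_one, smul_sub, smul_smul]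
  push_cast
  have e1 : (c : ℂ) * (c : ℂ)⁻¹ = 1 := mul_inv_cancel₀ hc'
  have e2 : (c : ℂ) * ((c : ℂ)⁻¹ * (c : ℂ)⁻¹) = (c : ℂ)⁻¹ := by field_simp
  simp only [e1, e2]
  module

end LinearAlgebra

/-! ### Ensembles and their source states -/

namespace PureEnsemble

variable {ι D : Type*} [Fintype D]

lemma proj_posSemidef (E : PureEnsemble ι D) (i : ι) : (E.proj i).PosSemidef :=
  posSemidef_vecMulVec_self_star _

lemma proj_trace (E : PureEnsemble ι D) (i : ι) : (E.proj i).trace = 1 := by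
  rw [proj, trace_vecMulVec, dotProduct_comm, E.signal_unit]

lemma HasSourceState.hasSum_trace {E : PureEnsemble ι D} {ρ : Matrix D D ℂ}
    (h : E.HasSourceState ρ) (X : Matrix D D ℂ) :
    HasSum (fun i => E.prob i * (X * E.proj i).trace.re) (X * ρ).trace.re := by
  let φ : Matrix D D ℂ →+ ℝ :=
    Complex.reAddGroupHom.comp ((traceAddMonoidHom D ℂ).comp (AddMonoidHom.mulLeft X))
  have hφ : Continuous φ := by
    change Continuous fun Y : Matrix D D ℂ => (X * Y).trace.re
    fun_prop
  have := HasSum.map h φ hφ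
  refine this.congr_fun fun i => ?_
  change E.prob i * _ = (X * ((E.prob i : ℂ) • E.proj i)).trace.re
  rw [Matrix.mul_smul, trace_smul, smul_eq_mul, Complex.re_ofReal_mul]

lemma HasSourceState.mix {ι₁ ι₂ : Type*} {t : ℝ} (ht : t ∈ Set.Ioo (0 : ℝ) 1)
    {E₁ : PureEnsemble ι₁ D} {E₂ : PureEnsemble ι₂ D} {ρ₁ ρ₂ : Matrix D D ℂ}
    (h₁ : E₁.HasSourceState ρ₁) (h₂ : E₂.HasSourceState ρ₂) :
    (E₁.mix t ht E₂).HasSourceState ((t : ℂ) • ρ₁ + ((1 - t : ℝ) : ℂ) • ρ₂) := by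
  refine HasSum.sum ?_ ?_
  · refine (HasSum.const_smul (t : ℂ) h₁).congr_fun fun i => ?_
    ext x y
    simp [PureEnsemble.mix, PureEnsemble.proj]
    ring
  · refine (HasSum.const_smul ((1 - t : ℝ) : ℂ) h₂).congr_fun fun i => ?_
    ext x y
    simp [PureEnsemble.mix, PureEnsemble.proj]
    ring

/-- The trace of `σ i ψ_i` is between `0` and `1` for `0 ≤ σ i ≤ 1`, so average fidelities
converge. -/
lemma summable_fidelity [DecidableEq D] (E : PureEnsemble ι D) {σ : ι → Matrix D D ℂ}
    (h0 : ∀ i, (σ i).PosSemidef) (h1 : ∀ i, (1 - σ i).PosSemidef) :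
    Summable fun i => E.prob i * (σ i * E.proj i).trace.re := by
  refine Summable.of_nonneg_of_le
    (fun i => mul_nonneg (E.prob_nonneg i) (trace_mul_re_nonneg (h0 i) (E.proj_posSemidef i)))
    (fun i => ?_) E.prob_hasSum.summable
  have := trace_mul_re_le (h1 i) (E.proj_posSemidef i)
  rw [Matrix.one_mul, E.proj_trace, Complex.one_re] at this
  exact mul_le_of_le_one_right (E.prob_nonneg i) this

/-- Converse bound. With `P` the spectral projection of the source state onto `A` and `Q = 1 - P`,
the inequality `σ ≤ (1 + c) P σ P + (1 + c⁻¹) Q σ Q` is averaged; the first term is at most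
`P`, and the second at most `Q W Q`, whose overlap with the source state is that of `W` with
`Q ρ Q ≤ s`. -/
theorem HasSourceState.fidelity_le [DecidableEq D] {E : PureEnsemble ι D} {U : Matrix D D ℂ}
    {q : D → ℝ} (hE : E.HasSourceState (spectralMatrix U q)) (hU : Uᴴ * U = 1)
    (A : Finset D) {s : ℝ} (hs : 0 ≤ s) (hq : ∀ a ∉ A, q a ≤ s)
    {σ : ι → Matrix D D ℂ} {W : Matrix D D ℂ}
    (h0 : ∀ i, (σ i).PosSemidef) (h1 : ∀ i, (1 - σ i).PosSemidef)
    (hW : ∀ i, (W - σ i).PosSemidef) (hW0 : W.PosSemidef) {c : ℝ} (hc : 0 < c) :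
    ∑' i, E.prob i * (σ i * E.proj i).trace.re
      ≤ (1 + c) * ∑ a ∈ A, q a + (1 + c⁻¹) * (s * W.trace.re) := by
  set f : D → ℝ := fun a => if a ∈ A then 1 else 0 with hf
  set P := spectralMatrix U f with hP
  have hPh : P.IsHermitian := spectralMatrix_isHermitian
  have hPP : P * P = P := by
    rw [hP, spectralMatrix_mul hU]; congr 1; ext a; simp [hf]
  have hone : (1 : Matrix D D ℂ) = spectralMatrix U fun _ => 1 := by
    rw [spectralMatrix_const hU]; simp
  set Q := 1 - P with hQ
  have hQh : Q.IsHermitian := isHermitian_one.sub hPh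
  have hQs : Q = spectralMatrix U fun a => 1 - f a := by rw [hQ, hP, hone, spectralMatrix_sub]
  have hcongr : ∀ {X Y R : Matrix D D ℂ}, R.IsHermitian → (Y - X).PosSemidef →
      (R * Y * R - R * X * R).PosSemidef := by
    intro X Y R hR h
    have := h.mul_mul_conjTranspose_same R
    rwa [hR.eq, Matrix.mul_sub, Matrix.sub_mul] at this
  have hsum1 := (hE.hasSum_trace P).mul_left (1 + c)
  have hsum2 := (hE.hasSum_trace (Q * W * Q)).mul_left (1 + c⁻¹)
  have hsum := hsum1.add hsum2
  have hle := hasSum_le (fun i => ?_) (E.summable_fidelity h0 h1).hasSum hsum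
  · refine hle.trans (add_le_add (mul_le_mul_of_nonneg_left (le_of_eq ?_) (by positivity))
      (mul_le_mul_of_nonneg_left ?_ (by positivity)))
    · rw [hP, spectralMatrix_mul hU, spectralMatrix_trace hU]
      simp [hf, Finset.sum_ite_mem]
    · have e : (Q * W * Q * spectralMatrix U q).trace = (Q * spectralMatrix U q * Q * W).trace := by
        rw [Matrix.mul_assoc, Matrix.mul_assoc, trace_mul_comm, trace_mul_comm _ W]
        rw [trace_mul_comm]
        simp only [Matrix.mul_assoc]
        rw [trace_mul_comm]
        simp only [Matrix.mul_assoc]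
      rw [e]
      have : ((s : ℂ) • (1 : Matrix D D ℂ) - Q * spectralMatrix U q * Q).PosSemidef := by
        rw [hQs, spectralMatrix_mul hU, spectralMatrix_mul hU, ← spectralMatrix_const hU,
          spectralMatrix_sub]
        refine spectralMatrix_posSemidef fun a => ?_
        by_cases ha : a ∈ A
        · simp [hf, ha, hs]
        · simpa [hf, ha] using hq a ha
      have := trace_mul_re_le this hW0
      simpa using this
  · have hp := E.proj_posSemidef i
    have e1 := trace_mul_re_le (pinching_posSemidef (h0 i) hPh hc) hp
    have e2 := trace_mul_re_le (hcongr hPh (h1 i)) hp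
    have e3 := trace_mul_re_le (hcongr hQh (hW i)) hp
    rw [Matrix.mul_one, hPP] at e2
    rw [Matrix.add_mul, trace_add, Complex.add_re, Matrix.smul_mul, Matrix.smul_mul, trace_smul,
      trace_smul, smul_eq_mul, smul_eq_mul, Complex.re_ofReal_mul, Complex.re_ofReal_mul] at e1
    have e4 : (σ i * E.proj i).trace.re ≤ (1 + c) * (P * E.proj i).trace.re
        + (1 + c⁻¹) * (Q * W * Q * E.proj i).trace.re :=
      e1.trans (add_le_add (mul_le_mul_of_nonneg_left e2 (by positivity))
        (mul_le_mul_of_nonneg_left e3 (by positivity)))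
    calc _ ≤ _ := mul_le_mul_of_nonneg_left e4 (E.prob_nonneg i)
      _ = _ := by ring

end PureEnsemble

/-! ### The converse for visible codes -/

section Codes

open scoped MatrixOrder Matrix.Norms.L2Operator CStarAlgebra

variable {ι κ D : Type*} [Fintype D] [DecidableEq D]

namespace VisibleCode

/-- The code whose encoder is restricted to (or pulled back along) a map of index sets. -/
def comap (C : VisibleCode ι D) (f : κ → ι) : VisibleCode κ D where
  M := C.M
  M_lt := C.M_lt
  enc k := C.enc (f k)
  enc_isState k := C.enc_isState (f k)
  dec := C.dec
  dec_trace := C.dec_trace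

lemma dec_sub_posSemidef (C : VisibleCode ι D) {X Y : Matrix (Fin C.M) (Fin C.M) ℂ}
    (h : (Y - X).PosSemidef) : (C.dec Y - C.dec X).PosSemidef :=
  Matrix.le_iff.mp (OrderHomClass.mono C.dec (Matrix.le_iff.mpr h))

lemma dec_posSemidef (C : VisibleCode ι D) {X : Matrix (Fin C.M) (Fin C.M) ℂ}
    (h : X.PosSemidef) : (C.dec X).PosSemidef := by
  simpa using C.dec_sub_posSemidef (X := 0) (Y := X) (by simpa using h)

lemma isState_dec_enc (C : VisibleCode ι D) (i : ι) : IsState (C.dec (C.enc i)) :=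
  ⟨C.dec_posSemidef (C.enc_isState i).1, by rw [C.dec_trace, (C.enc_isState i).2]⟩

lemma summable_avgFidelity (E : PureEnsemble ι D) (C : VisibleCode ι D) :
    Summable fun i => E.prob i * (C.dec (C.enc i) * E.proj i).trace.re :=
  E.summable_fidelity (fun i => (C.isState_dec_enc i).1)
    (fun i => (C.isState_dec_enc i).one_sub_posSemidef)

end VisibleCode

/-- The fidelity of a visible code, in terms of the spectrum of the source state only: the encoded
states are at most `1`, so the outputs are at most the image of `1`, which has trace `M`. -/
theorem avgFidelity_le {E : PureEnsemble ι D} {U : Matrix D D ℂ}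
    {q : D → ℝ} (hE : E.HasSourceState (spectralMatrix U q)) (hU : Uᴴ * U = 1)
    (C : VisibleCode ι D) {s : ℝ} (hs : 0 ≤ s) {c : ℝ} (hc : 0 < c) :
    avgFidelity E C ≤ (1 + c) * ∑ a with s ≤ q a, q a + (1 + c⁻¹) * (s * C.M) := by
  have h := hE.fidelity_le hU {a | s ≤ q a} hs (fun a ha => ?_)
    (fun i => (C.isState_dec_enc i).1) (fun i => (C.isState_dec_enc i).one_sub_posSemidef)
    (fun i => C.dec_sub_posSemidef (C.enc_isState i).one_sub_posSemidef)
    (C.dec_posSemidef PosSemidef.one) hc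
  · rw [avgFidelity]
    simpa [C.dec_trace] using h
  · simpa using (not_le.mp (by simpa using ha)).le

lemma avgFidelity_mix {ι₁ ι₂ : Type*} {t : ℝ} (ht : t ∈ Set.Ioo (0 : ℝ) 1)
    (E₁ : PureEnsemble ι₁ D) (E₂ : PureEnsemble ι₂ D) (C : VisibleCode (ι₁ ⊕ ι₂) D) :
    avgFidelity (E₁.mix t ht E₂) C
      = t * avgFidelity E₁ (C.comap Sum.inl) + (1 - t) * avgFidelity E₂ (C.comap Sum.inr) := by
  have h1 := ((VisibleCode.summable_avgFidelity E₁ (C.comap Sum.inl)).hasSum).mul_left t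
  have h2 := ((VisibleCode.summable_avgFidelity E₂ (C.comap Sum.inr)).hasSum).mul_left (1 - t)
  refine HasSum.tsum_eq (HasSum.sum ?_ ?_)
  · exact h1.congr_fun fun i => mul_assoc t (E₁.prob i) _
  · exact h2.congr_fun fun i => mul_assoc (1 - t) (E₂.prob i) _

end Codes

/-! ### Powers of a memoryless source -/

section TensorPower

variable {d : Type*}

/-- The tensor power `A ⊗ ⋯ ⊗ A`, as a matrix indexed by strings. -/
def tensorPower (A : Matrix d d ℂ) (n : ℕ) : Matrix (Fin n → d) (Fin n → d) ℂ :=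
  of fun x y => ∏ k, A (x k) (y k)

lemma tensorPower_mul [Fintype d] (A B : Matrix d d ℂ) (n : ℕ) :
    tensorPower (A * B) n = tensorPower A n * tensorPower B n := by
  classical
  ext x y
  simp only [tensorPower, of_apply, mul_apply, ← Finset.prod_mul_distrib]
  rw [Finset.prod_univ_sum (fun _ => Finset.univ) (fun k j => A (x k) j * B j (y k)),
    Fintype.piFinset_univ]

lemma tensorPower_conjTranspose (A : Matrix d d ℂ) (n : ℕ) :
    tensorPower Aᴴ n = (tensorPower A n)ᴴ := by
  ext x y
  simp [tensorPower, conjTranspose_apply, star_prod]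

lemma tensorPower_diagonal [DecidableEq d] (f : d → ℂ) (n : ℕ) :
    tensorPower (diagonal f) n = diagonal fun a : Fin n → d => ∏ k, f (a k) := by
  ext x y
  simp only [tensorPower, of_apply, diagonal_apply]
  split_ifs with h
  · subst h; simp
  · obtain ⟨k, hk⟩ := Function.ne_iff.mp h
    exact Finset.prod_eq_zero (Finset.mem_univ k) (by simp [hk])

lemma tensorPower_one [DecidableEq d] (n : ℕ) : tensorPower (1 : Matrix d d ℂ) n = 1 := by
  rw [← diagonal_one, tensorPower_diagonal]
  simp

lemma tensorPower_spectralMatrix [Fintype d] [DecidableEq d] (U : Matrix d d ℂ) (p : d → ℝ) (n : ℕ) :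
    tensorPower (spectralMatrix U p) n
      = spectralMatrix (tensorPower U n) fun a => ∏ k, p (a k) := by
  rw [spectralMatrix, tensorPower_mul, tensorPower_mul, tensorPower_diagonal,
    tensorPower_conjTranspose, spectralMatrix]
  push_cast
  rfl

lemma tensorPower_isometry [Fintype d] [DecidableEq d] {U : Matrix d d ℂ} (hU : Uᴴ * U = 1) (n : ℕ) :
    (tensorPower U n)ᴴ * tensorPower U n = 1 := by
  rw [← tensorPower_conjTranspose, ← tensorPower_mul, hU, tensorPower_one]

/-- The product of `n` series over the same index set, as a series over strings. -/
lemma hasSum_pi_prod {ι : Type*} : ∀ {n : ℕ} {f : Fin n → ι → ℂ} {s : Fin n → ℂ},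
    (∀ k, HasSum (f k) (s k)) → HasSum (fun i : Fin n → ι => ∏ k, f k (i k)) (∏ k, s k) := by
  intro n
  induction n with
  | zero =>
    intro f s _
    simp
  | succ n ih =>
    intro f s hf
    have ih' := ih (f := fun k => f k.succ) (s := fun k => s k.succ) fun k => hf k.succ
    have hs := summable_mul_of_summable_norm (hf 0).summable.norm ih'.summable.norm
    have h := (hf 0).mul ih' hs
    rw [Fin.prod_univ_succ, ← (Fin.consEquiv fun _ : Fin (n + 1) => ι).hasSum_iff]
    refine h.congr_fun ?_
    intro x
    simp [Fin.prod_univ_succ, Fin.consEquiv]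

lemma PureEnsemble.HasSourceState.power [Fintype d] {ι : Type*} {E : PureEnsemble ι d} {ρ : Matrix d d ℂ}
    (h : E.HasSourceState ρ) (n : ℕ) : (E.power n).HasSourceState (tensorPower ρ n) := by
  have h' : ∀ x y, HasSum (fun i => (E.prob i : ℂ) * E.proj i x y) (ρ x y) := fun x y =>
    Pi.hasSum.mp (Pi.hasSum.mp h x) y
  refine Pi.hasSum.mpr fun x => Pi.hasSum.mpr fun y => ?_
  refine (hasSum_pi_prod fun k => h' (x k) (y k)).congr_fun fun i => ?_
  simp [PureEnsemble.power, PureEnsemble.proj, vecMulVec_apply, Finset.prod_mul_distrib, star_prod]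

end TensorPower

/-! ### Spectral tails of product distributions -/

section Tail

open MeasureTheory ProbabilityTheory
open scoped Topology

variable {d : Type*} [Fintype d]

/-- The probability, under the `n`-fold product of the distribution `p`, of the strings whose
probability is at least `s`. -/
def tailMass (p : d → ℝ) (n : ℕ) (s : ℝ) : ℝ :=
  ∑ a : Fin n → d with s ≤ ∏ k, p (a k), ∏ k, p (a k)

lemma sum_prod_eq_one {p : d → ℝ} (h1 : ∑ a, p a = 1) (n : ℕ) :
    ∑ a : Fin n → d, ∏ k, p (a k) = 1 := by
  classical
  rw [← Fintype.piFinset_univ, ← Finset.prod_univ_sum (fun _ => Finset.univ) fun _ j => p j, h1]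
  simp

lemma tailMass_nonneg {p : d → ℝ} (h0 : ∀ a, 0 ≤ p a) (n : ℕ) (s : ℝ) : 0 ≤ tailMass p n s :=
  Finset.sum_nonneg fun _ _ => Finset.prod_nonneg fun _ _ => h0 _

lemma tailMass_anti {p : d → ℝ} (h0 : ∀ a, 0 ≤ p a) (n : ℕ) {s s' : ℝ} (h : s ≤ s') :
    tailMass p n s' ≤ tailMass p n s :=
  Finset.sum_le_sum_of_subset_of_nonneg
    (fun a ha => by simpa using h.trans (by simpa using ha))
    fun _ _ _ => Finset.prod_nonneg fun _ _ => h0 _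

lemma tailMass_le_one {p : d → ℝ} (h0 : ∀ a, 0 ≤ p a) (h1 : ∑ a, p a = 1) (n : ℕ) (s : ℝ) :
    tailMass p n s ≤ 1 := by
  rw [← sum_prod_eq_one h1 n]
  exact Finset.sum_le_sum_of_subset_of_nonneg (Finset.subset_univ _)
    fun _ _ _ => Finset.prod_nonneg fun _ _ => h0 _

/-- At most `1 / s` strings have probability at least `s`. -/
lemma card_mul_le_one {p : d → ℝ} (h0 : ∀ a, 0 ≤ p a) (h1 : ∑ a, p a = 1) (n : ℕ) (s : ℝ) :
    (Finset.card {a : Fin n → d | s ≤ ∏ k, p (a k)} : ℝ) * s ≤ 1 := by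
  refine le_trans ?_ (tailMass_le_one h0 h1 n s)
  rw [← nsmul_eq_mul]
  exact Finset.card_nsmul_le_sum _ _ _ fun a ha => by simpa using ha

lemma Phi_eq (x : ℝ) : Phi x = (gaussianReal 0 1).real (Set.Iic x) := cdf_eq_real _ _

lemma gaussianReal_Iic {s : ℝ} (hs : 0 < s) (x : ℝ) :
    (gaussianReal 0 (s ^ 2).toNNReal).real (Set.Iic x) = Phi (x / s) := by
  have h : (gaussianReal 0 1).map (fun y => s * y) = gaussianReal 0 (s ^ 2).toNNReal := by
    rw [gaussianReal_map_const_mul]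
    congr 1
    · simp
    · rw [mul_one]; ext; simp [sq_nonneg]
  rw [← h, map_measureReal_apply (by fun_prop) measurableSet_Iic, Phi_eq]
  congr 1
  ext y
  simp [le_div_iff₀' hs]

section

variable {p : d → ℝ} {H V : ℝ}

/-- If the information content `- log p` has variance zero, then it is constant on the support. -/
lemma eq_rpow_of_variance_eq_zero (h0 : ∀ a, 0 ≤ p a) (h1 : ∑ a, p a = 1)
    (hH : H = -∑ a, p a * Real.logb 2 (p a))
    (hV : ∑ a, p a * Real.logb 2 (p a) ^ 2 - H ^ 2 = 0) {a : d} (ha : p a ≠ 0) :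
    p a = 2 ^ (-H) := by
  have h2 : ∑ a, p a * (Real.logb 2 (p a) + H) ^ 2 = 0 := by
    calc ∑ a, p a * (Real.logb 2 (p a) + H) ^ 2
        = ∑ a, (p a * Real.logb 2 (p a) ^ 2 + 2 * H * (p a * Real.logb 2 (p a)) + H ^ 2 * p a) :=
          Finset.sum_congr rfl fun a _ => by ring
      _ = ∑ a, p a * Real.logb 2 (p a) ^ 2 - H ^ 2 := by
          rw [Finset.sum_add_distrib, Finset.sum_add_distrib, ← Finset.mul_sum, ← Finset.mul_sum,
            h1]
          have : ∑ a, p a * Real.logb 2 (p a) = -H := by rw [hH, neg_neg]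
          rw [this]; ring
      _ = 0 := hV
  have h3 := (Finset.sum_eq_zero_iff_of_nonneg fun a _ =>
    mul_nonneg (h0 a) (sq_nonneg _)).mp h2 a (Finset.mem_univ a)
  have h4 : Real.logb 2 (p a) = -H := by
    have := pow_eq_zero_iff (two_ne_zero) |>.mp ((mul_eq_zero.mp h3).resolve_left ha)
    linarith
  rw [← h4, Real.rpow_logb (by norm_num) (by norm_num) (lt_of_le_of_ne (h0 a) ha.symm)]

lemma tailMass_of_variance_eq_zero (h0 : ∀ a, 0 ≤ p a) (h1 : ∑ a, p a = 1)
    (hH : H = -∑ a, p a * Real.logb 2 (p a))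
    (hV : ∑ a, p a * Real.logb 2 (p a) ^ 2 - H ^ 2 = 0) {n : ℕ} (hn : 0 < n) (x : ℝ) :
    tailMass p n (2 ^ (-(n * H + √n * x))) = if x < 0 then 0 else 1 := by
  have hsqrt : 0 < √(n : ℝ) := Real.sqrt_pos.mpr (by exact_mod_cast hn)
  have key : ∀ a : Fin n → d, ∏ k, p (a k) ≠ 0 → ∏ k, p (a k) = 2 ^ (-(n * H) : ℝ) := by
    intro a ha
    rw [Finset.prod_congr rfl fun k _ => eq_rpow_of_variance_eq_zero h0 h1 hH hV
      (Finset.prod_ne_zero_iff.mp ha k (Finset.mem_univ k))]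
    rw [Finset.prod_const, Finset.card_univ, Fintype.card_fin, ← Real.rpow_natCast,
      ← Real.rpow_mul (by norm_num)]
    congr 1; ring
  split_ifs with hx
  · refine Finset.sum_eq_zero fun a ha => ?_
    by_contra hne
    have h2 : (2 : ℝ) ^ (-(n * H + √n * x)) ≤ ∏ k, p (a k) := by simpa using ha
    rw [key a hne, Real.rpow_le_rpow_left_iff (by norm_num)] at h2
    have : √(n : ℝ) * x < 0 := mul_neg_of_pos_of_neg hsqrt hx
    linarith
  · rw [← sum_prod_eq_one h1 n, tailMass]
    refine Finset.sum_filter_of_ne fun a _ hne => ?_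
    rw [key a hne, Real.rpow_le_rpow_left_iff (by norm_num)]
    have : 0 ≤ √(n : ℝ) * x := mul_nonneg hsqrt.le (not_lt.mp hx)
    linarith

/-- The central limit theorem for the information content of a memoryless source: the strings of
probability at least `2 ^ (-(n H + √n x))` have total probability tending to `Φ (x / σ)`. -/
theorem tendsto_tailMass (h0 : ∀ a, 0 ≤ p a) (h1 : ∑ a, p a = 1)
    (hH : H = -∑ a, p a * Real.logb 2 (p a))
    (hV : V = ∑ a, p a * Real.logb 2 (p a) ^ 2 - H ^ 2) (x : ℝ) :
    Tendsto (fun n : ℕ => tailMass p n (2 ^ (-(n * H + √n * x)))) atTop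
      (𝓝 (scaledPhi √V x)) := by
  let _ : MeasurableSpace d := ⊤
  have hsum : ∑ a, ENNReal.ofReal (p a) = 1 := by
    rw [← ENNReal.ofReal_sum_of_nonneg fun a _ => h0 a, h1, ENNReal.ofReal_one]
  let μ : Measure d := (PMF.ofFintype (fun a => ENNReal.ofReal (p a)) hsum).toMeasure
  have hμ : ∀ a, μ.real {a} = p a := fun a => by
    rw [measureReal_def, PMF.toMeasure_apply_singleton _ _ (MeasurableSet.singleton a),
      PMF.ofFintype_apply, ENNReal.toReal_ofReal (h0 a)]
  let P : Measure (ℕ → d) := Measure.infinitePi fun _ => μ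
  let Y : d → ℝ := fun a => -Real.logb 2 (p a)
  let X : ℕ → (ℕ → d) → ℝ := fun k ω => Y (ω k)
  have hY : Measurable Y := measurable_of_countable Y
  have hlaw : ∀ k, P.map (fun ω => ω k) = μ := fun k => Measure.infinitePi_map_eval (fun _ => μ) k
  have hX : ∀ k, Measurable (X k) := fun k => hY.comp (measurable_pi_apply k)
  have hint : ∀ f : d → ℝ, ∫ ω, f (ω 0) ∂P = ∑ a, p a * f a := by
    intro f
    rw [← integral_map (φ := fun ω : ℕ → d => ω 0) (measurable_pi_apply 0).aemeasurable
      (measurable_of_countable f).aestronglyMeasurable, hlaw, integral_fintype]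
    · simp [hμ]
    · exact .of_finite
  have hmemLp : MemLp (X 0) 2 P := by
    have : MemLp Y 2 (P.map fun ω => ω 0) := by rw [hlaw]; exact .of_discrete
    exact this.comp_of_map (measurable_pi_apply 0).aemeasurable
  have hmean : P[X 0] = H := by
    rw [hint Y, hH]; simp [Y]
  have hvar : Var[X 0; P] = V := by
    rw [variance_eq_sub hmemLp, hmean, hV]
    congr 1
    refine (hint fun a => Y a ^ 2).trans (Finset.sum_congr rfl fun a _ => ?_)
    simp [Y]
  have hVnn : 0 ≤ V := hvar ▸ variance_nonneg _ _
  by_cases hV0 : V = 0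
  · refine tendsto_const_nhds.congr' ?_
    filter_upwards [eventually_gt_atTop 0] with n hn
    rw [tailMass_of_variance_eq_zero h0 h1 hH (hV ▸ hV0) hn, scaledPhi]
    simp [hV0]
  have hVpos : 0 < V := lt_of_le_of_ne hVnn (Ne.symm hV0)
  have hs : 0 < √V := Real.sqrt_pos.mpr hVpos
  have hindep : iIndepFun X P := iIndepFun_infinitePi (X := fun _ => Y) fun _ => hY
  have hident : ∀ k, IdentDistrib (X k) (X 0) P P := fun k => by
    refine ⟨(hX k).aemeasurable, (hX 0).aemeasurable, ?_⟩
    have : ∀ k, P.map (X k) = μ.map Y := fun k => by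
      rw [← hlaw k, Measure.map_map hY (measurable_pi_apply k)]; rfl
    rw [this, this]
  have hlawid : HasLaw id (gaussianReal 0 Var[X 0; P].toNNReal)
      (gaussianReal 0 Var[X 0; P].toNNReal) := HasLaw.id
  have hclt := (tendstoInDistribution_inv_sqrt_mul_sum_sub hlawid hmemLp hindep hident)
  have hlim : Tendsto (fun n : ℕ => (P.map fun ω =>
      (√(n : ℝ))⁻¹ * (∑ k ∈ Finset.range n, X k ω - n * P[X 0])) (Set.Iic x)) atTop
      (𝓝 ((gaussianReal 0 Var[X 0; P].toNNReal).map id (Set.Iic x))) :=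
    ProbabilityMeasure.tendsto_measure_of_null_frontier_of_tendsto' hclt.tendsto (by
      have : (Var[X 0; P].toNNReal) ≠ 0 := by
        rw [hvar]; simpa using hVpos
      have := nullSingletonClass_gaussianReal (μ := 0) this
      simp)
  rw [Measure.map_id] at hlim
  have hlim' := (ENNReal.tendsto_toReal (measure_ne_top _ _)).comp hlim
  have hval : ((gaussianReal 0 Var[X 0; P].toNNReal) (Set.Iic x)).toReal = scaledPhi √V x := by
    rw [scaledPhi, if_neg hs.ne', ← gaussianReal_Iic hs, Real.sq_sqrt hVnn, hvar, measureReal_def]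
  rw [hval] at hlim'
  refine hlim'.congr' ?_
  filter_upwards [eventually_gt_atTop 0] with n hn
  have hsqrt : 0 < √(n : ℝ) := Real.sqrt_pos.mpr (by exact_mod_cast hn)
  have hrestr : P.map (fun ω (k : Fin n) => ω k) = Measure.pi fun _ => μ := by
    have := Measure.map_infinitePi_infinitePi_of_inj (P := fun _ : ℕ => μ)
      (f := fun k : Fin n => (k : ℕ)) Fin.val_injective
    rw [← Measure.infinitePi_eq_pi]
    exact this
  have hmeasY : Measurable fun a : Fin n → d => (√(n : ℝ))⁻¹ * (∑ k, Y (a k) - n * H) := by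
    fun_prop
  let A : Set (Fin n → d) := {a | (√(n : ℝ))⁻¹ * (∑ k, Y (a k) - n * H) ≤ x}
  have hA : MeasurableSet A := hmeasY measurableSet_Iic
  have hstep : (P.map (fun ω => (√(n : ℝ))⁻¹ * (∑ k ∈ Finset.range n, X k ω - n * P[X 0]))).real
      (Set.Iic x) = (Measure.pi fun _ : Fin n => μ).real A := by
    rw [← hrestr, map_measureReal_apply (by fun_prop) measurableSet_Iic,
      map_measureReal_apply (by fun_prop) hA]
    congr 1
    ext ω
    simp only [A, Set.mem_preimage, Set.mem_Iic, Set.mem_ofPred_eq, hmean, X]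
    rw [Fin.sum_univ_eq_sum_range (fun k => Y (ω k))]
  have hpi : ∀ a : Fin n → d, (Measure.pi fun _ : Fin n => μ).real {a} = ∏ k, p (a k) := by
    intro a
    rw [measureReal_def, Measure.pi_singleton, ENNReal.toReal_prod]
    exact Finset.prod_congr rfl fun k _ => hμ (a k)
  classical
  change (P.map (fun ω => (√(n : ℝ))⁻¹ *
    (∑ k ∈ Finset.range n, X k ω - n * P[X 0]))).real (Set.Iic x) = _
  rw [hstep]
  have : A = ((Finset.univ.filter fun a => a ∈ A : Finset (Fin n → d)) : Set (Fin n → d)) := by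
    ext a; simp
  rw [this, ← sum_measureReal_singleton, tailMass, Finset.sum_filter, Finset.sum_filter]
  refine Finset.sum_congr rfl fun a _ => ?_
  rw [hpi]
  -- Strings of probability zero, where the logarithm is a junk value, contribute nothing to
  -- either sum.
  by_cases hne : ∏ k, p (a k) = 0
  · simp [hne]
  have hpos : ∀ k, p (a k) ≠ 0 := fun k => Finset.prod_ne_zero_iff.mp hne k (Finset.mem_univ k)
  have hppos : 0 < ∏ k, p (a k) := Finset.prod_pos fun k _ => lt_of_le_of_ne (h0 _) (hpos k).symm
  have hlog : Real.logb 2 (∏ k, p (a k)) = -∑ k, Y (a k) := by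
    rw [Real.logb_prod _ _ fun k _ => hpos k]; simp [Y]
  refine if_congr ?_ rfl rfl
  rw [Real.le_logb_iff_rpow_le (by norm_num) hppos |>.symm, hlog]
  simp only [A, Set.mem_ofPred_eq]
  rw [inv_mul_le_iff₀ hsqrt]
  constructor <;> intro h <;> linarith

end

end Tail

/-! ### Codes from subspaces -/

section DirectPart

open scoped MatrixOrder Matrix.Norms.L2Operator CStarAlgebra

variable {D : Type*} [Fintype D]

/-- An isometry whose range is the span of a finite set of vectors. -/
lemma exists_isometry (S : Finset (D → ℂ)) : ∃ M ≤ S.card, ∃ V : Matrix D (Fin M) ℂ,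
    Vᴴ * V = 1 ∧ ∀ v ∈ S, (V * Vᴴ) *ᵥ v = v := by
  classical
  let T : Finset (EuclideanSpace ℂ D) := S.image (WithLp.toLp 2)
  let W : Submodule ℂ (EuclideanSpace ℂ D) := Submodule.span ℂ T
  let b := stdOrthonormalBasis ℂ W
  refine ⟨Module.finrank ℂ W, (finrank_span_finset_le_card T).trans Finset.card_image_le,
    of fun x j => (b j : EuclideanSpace ℂ D) x, ?_, ?_⟩
  · ext j k
    have h := orthonormal_iff_ite.mp b.orthonormal j k
    rw [Submodule.coe_inner, EuclideanSpace.inner_eq_star_dotProduct] at h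
    rw [one_apply, ← h, mul_apply]
    simp [dotProduct, mul_comm]
  · intro v hv
    have hvW : WithLp.toLp 2 v ∈ W :=
      Submodule.subset_span (by simpa [T] using hv)
    have h := congrArg (Subtype.val) (b.sum_repr' ⟨_, hvW⟩)
    ext x
    have hx := congrArg (fun w : EuclideanSpace ℂ D => w x) h
    simp only [Submodule.coe_inner, EuclideanSpace.inner_eq_star_dotProduct] at hx
    rw [← mulVec_mulVec]
    simp only [AddSubmonoidClass.coe_finsetSum, SetLike.val_smul, WithLp.ofLp_sum,
      WithLp.ofLp_smul, Finset.sum_apply, Pi.smul_apply, smul_eq_mul] at hx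
    rw [← hx]
    simp only [mulVec, dotProduct, of_apply, conjTranspose_apply, Pi.star_apply]
    refine Finset.sum_congr rfl fun j _ => ?_
    rw [mul_comm]
    congr 1
    exact Finset.sum_congr rfl fun y _ => mul_comm _ _

variable [DecidableEq D]

/-- Conjugation `X ↦ V X Vᴴ` by an isometry, as a (non-unital) star homomorphism. -/
def isometryHom {M : ℕ} (V : Matrix D (Fin M) ℂ) (hV : Vᴴ * V = 1) :
    Matrix (Fin M) (Fin M) ℂ →⋆ₙₐ[ℂ] Matrix D D ℂ where
  toFun X := V * X * Vᴴ
  map_smul' c X := by simp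
  map_zero' := by simp
  map_add' X Y := by rw [Matrix.mul_add, Matrix.add_mul]
  map_mul' X Y := by
    calc
      V * (X * Y) * Vᴴ = V * X * (1 : Matrix (Fin M) (Fin M) ℂ) * Y * Vᴴ := by
        simp only [Matrix.mul_one, Matrix.mul_assoc]
      _ = V * X * Vᴴ * (V * Y * Vᴴ) := by rw [← hV]; simp only [Matrix.mul_assoc]
  map_star' X := by
    simp only [star_eq_conjTranspose, conjTranspose_mul, conjTranspose_conjTranspose,
      Matrix.mul_assoc]

open scoped Classical in
/-- The normalised projector onto the line of `v`, and an arbitrary pure state if `v = 0`. -/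
def lineState {M : ℕ} [NeZero M] (v : Fin M → ℂ) : Matrix (Fin M) (Fin M) ℂ :=
  if v = 0 then vecMulVec (Pi.single 0 1) (star (Pi.single 0 1))
  else (star v ⬝ᵥ v)⁻¹ • vecMulVec v (star v)

lemma lineState_isState {M : ℕ} [NeZero M] (v : Fin M → ℂ) : IsState (lineState v) := by
  unfold lineState
  split_ifs with h
  · refine ⟨posSemidef_vecMulVec_self_star _, ?_⟩
    rw [trace_vecMulVec]; simp
  · refine ⟨(posSemidef_vecMulVec_self_star v).smul (inv_nonneg.mpr (dotProduct_star_self_nonneg v)),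
      ?_⟩
    rw [trace_smul, trace_vecMulVec, dotProduct_comm, smul_eq_mul,
      inv_mul_cancel₀ (by simpa [dotProduct_star_self_eq_zero] using h)]

/-- The visible code that compresses the signals to the range of an isometry `V`: the encoder
prepares the normalised `Vᴴ ψ`, the decoder applies `V`. -/
def isometryCode {ι : Type*} (E : PureEnsemble ι D) {M : ℕ} [NeZero M] (hM : M < Fintype.card D)
    (V : Matrix D (Fin M) ℂ) (hV : Vᴴ * V = 1) : VisibleCode ι D where
  M := M
  M_lt := hM
  enc i := lineState (Vᴴ *ᵥ E.signal i)
  enc_isState i := lineState_isState _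
  dec := CompletelyPositiveMapClass.toCompletelyPositiveLinearMap (isometryHom V hV)
  dec_trace X := by
    change (V * X * Vᴴ).trace = _
    rw [trace_mul_comm, ← Matrix.mul_assoc, hV, Matrix.one_mul]

/-- The fidelity of a signal is `‖Vᴴ ψ‖²` (for `Vᴴ ψ = 0` it is only bounded below by it), which
averages to the overlap of the source state with the projection `V Vᴴ`. -/
lemma trace_le_avgFidelity_isometryCode {ι : Type*} {E : PureEnsemble ι D} {ρ : Matrix D D ℂ}
    (hE : E.HasSourceState ρ) {M : ℕ} [NeZero M] (hM : M < Fintype.card D)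
    (V : Matrix D (Fin M) ℂ) (hV : Vᴴ * V = 1) :
    (V * Vᴴ * ρ).trace.re ≤ avgFidelity E (isometryCode E hM V hV) := by
  refine hasSum_le (fun i => mul_le_mul_of_nonneg_left ?_ (E.prob_nonneg i))
    (hE.hasSum_trace (V * Vᴴ)) (VisibleCode.summable_avgFidelity E _).hasSum
  set v := Vᴴ *ᵥ E.signal i with hv
  have hproj : Vᴴ * E.proj i * V = vecMulVec v (star v) := by
    rw [PureEnsemble.proj, mul_vecMulVec, vecMulVec_mul, hv, star_mulVec, conjTranspose_conjTranspose]
  have htr : ∀ X : Matrix (Fin M) (Fin M) ℂ,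
      (V * X * Vᴴ * E.proj i).trace = (X * vecMulVec v (star v)).trace := by
    intro X
    rw [← hproj, Matrix.mul_assoc, Matrix.mul_assoc, trace_mul_comm]
    simp only [Matrix.mul_assoc]
  change _ ≤ (V * lineState v * Vᴴ * E.proj i).trace.re
  have h1 := htr 1
  rw [Matrix.mul_one, Matrix.one_mul, trace_vecMulVec] at h1
  rw [h1, htr, lineState]
  split_ifs with h
  · rw [h]; simp
  · have hne : star v ⬝ᵥ v ≠ 0 := by simpa [dotProduct_star_self_eq_zero] using h
    rw [Matrix.smul_mul, vecMulVec_mul_vecMulVec, vecMulVec_smul, trace_smul,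
      trace_smul, trace_vecMulVec, dotProduct_comm v, smul_eq_mul, smul_eq_mul, inv_mul_cancel_left₀ hne]

/-- A projection that fixes the eigenvectors in `A` captures at least their share of the state. -/
lemma sum_le_trace_mul_spectralMatrix {M : ℕ} {V : Matrix D (Fin M) ℂ} {U : Matrix D D ℂ}
    (hU : Uᴴ * U = 1) {q : D → ℝ} (hq : ∀ a, 0 ≤ q a) {A : Finset D}
    (hA : ∀ a ∈ A, (V * Vᴴ) *ᵥ Uᵀ a = Uᵀ a) :
    ∑ a ∈ A, q a ≤ (V * Vᴴ * spectralMatrix U q).trace.re := by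
  have h1 : (V * Vᴴ * spectralMatrix U q).trace.re
      = ∑ a, ((Uᴴ * (V * Vᴴ) * U) a a).re * q a := by
    rw [spectralMatrix, ← Matrix.mul_assoc, trace_mul_comm, ← Matrix.mul_assoc, ← Matrix.mul_assoc,
      trace, Complex.re_sum]
    refine Finset.sum_congr rfl fun a _ => ?_
    rw [diag_apply, mul_diagonal, Complex.re_mul_ofReal]
  have hpsd : (Uᴴ * (V * Vᴴ) * U).PosSemidef :=
    (posSemidef_self_mul_conjTranspose V).conjTranspose_mul_mul_same U
  have hone : ∀ a ∈ A, (Uᴴ * (V * Vᴴ) * U) a a = 1 := by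
    intro a ha
    have h2 : (Uᴴ * (V * Vᴴ) * U) a a = (Uᴴ *ᵥ ((V * Vᴴ) *ᵥ Uᵀ a)) a := by
      rw [mulVec_mulVec]
      rfl
    rw [h2, hA a ha]
    have := congrFun (congrFun hU a) a
    rw [one_apply_eq] at this
    exact this
  rw [h1]
  calc ∑ a ∈ A, q a = ∑ a ∈ A, ((Uᴴ * (V * Vᴴ) * U) a a).re * q a :=
        Finset.sum_congr rfl fun a ha => by rw [hone a ha]; simp
    _ ≤ _ := Finset.sum_le_sum_of_subset_of_nonneg (Finset.subset_univ A) fun a _ _ =>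
        mul_nonneg (Complex.le_def.mp hpsd.diag_nonneg).1 (hq a)

lemma neZero_of_fixes {M : ℕ} {V : Matrix D (Fin M) ℂ} {U : Matrix D D ℂ} (hU : Uᴴ * U = 1)
    {a : D} (h : (V * Vᴴ) *ᵥ Uᵀ a = Uᵀ a) : NeZero M := by
  refine ⟨fun hM => ?_⟩
  subst hM
  have h0 : V * Vᴴ = 0 := by ext x y; simp [mul_apply]
  rw [h0, zero_mulVec] at h
  have := congrFun (congrFun hU a) a
  rw [one_apply_eq, mul_apply] at this
  have h2 : ∀ x, U x a = 0 := fun x => (congrFun h x).symm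
  simp [h2] at this

/-- Direct coding bound. The code projects onto the span of the chosen eigenvectors of the two
components of the source state, and one more to make it nonzero. If that span is the whole space,
which the definition of a code excludes, the code projects instead onto the complement of the least
likely eigenvector of the source state, which costs at most `1 / dim`. -/
theorem exists_code [Nontrivial D] {ι : Type*} {E : PureEnsemble ι D} {ρ : Matrix D D ℂ}
    (hE : E.HasSourceState ρ) (hρ : IsState ρ) {t : ℝ} (ht : t ∈ Set.Ioo (0 : ℝ) 1)
    {U₁ U₂ : Matrix D D ℂ} (hU₁ : U₁ᴴ * U₁ = 1) (hU₂ : U₂ᴴ * U₂ = 1) {q₁ q₂ : D → ℝ}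
    (hq₁ : ∀ a, 0 ≤ q₁ a) (hq₂ : ∀ a, 0 ≤ q₂ a) (hs₁ : ∑ a, q₁ a = 1) (hs₂ : ∑ a, q₂ a = 1)
    (hρ' : ρ = (t : ℂ) • spectralMatrix U₁ q₁ + ((1 - t : ℝ) : ℂ) • spectralMatrix U₂ q₂)
    (A B : Finset D) :
    ∃ C : VisibleCode ι D, C.M ≤ A.card + B.card + 1 ∧ 0 < C.M ∧
      t * ∑ a ∈ A, q₁ a + (1 - t) * ∑ a ∈ B, q₂ a - (Fintype.card D : ℝ)⁻¹ ≤ avgFidelity E C := by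
  classical
  obtain ⟨e⟩ : Nonempty D := inferInstance
  have hcard : (0 : ℝ) < Fintype.card D := by exact_mod_cast Fintype.card_pos
  obtain ⟨M, hMle, V, hV, hfix⟩ :=
    exists_isometry (A.image U₁ᵀ ∪ B.image U₂ᵀ ∪ {U₁ᵀ e})
  have hMle' : M ≤ A.card + B.card + 1 := hMle.trans <|
    (Finset.card_union_le _ _).trans <| add_le_add ((Finset.card_union_le _ _).trans
      (add_le_add Finset.card_image_le Finset.card_image_le)) (by simp)
  by_cases hM : M < Fintype.card D
  · have hM0 : NeZero M := neZero_of_fixes hU₁ (hfix (U₁ᵀ e) (by simp))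
    refine ⟨isometryCode E hM V hV, hMle', Nat.pos_of_ne_zero hM0.out, ?_⟩
    refine le_trans ?_ (trace_le_avgFidelity_isometryCode hE hM V hV)
    have h1 := sum_le_trace_mul_spectralMatrix hU₁ hq₁ (V := V) (A := A) fun a ha =>
      hfix _ (by simp only [Finset.mem_union]; exact .inl (.inl (Finset.mem_image_of_mem _ ha)))
    have h2 := sum_le_trace_mul_spectralMatrix hU₂ hq₂ (V := V) (A := B) fun a ha =>
      hfix _ (by simp only [Finset.mem_union]; exact .inl (.inr (Finset.mem_image_of_mem _ ha)))
    rw [hρ', Matrix.mul_add, Matrix.mul_smul, Matrix.mul_smul, trace_add, trace_smul, trace_smul,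
      Complex.add_re, smul_eq_mul, smul_eq_mul, Complex.re_ofReal_mul, Complex.re_ofReal_mul]
    have := mul_le_mul_of_nonneg_left h1 ht.1.le
    have := mul_le_mul_of_nonneg_left h2 (sub_nonneg.mpr ht.2.le)
    have : (0 : ℝ) ≤ (Fintype.card D : ℝ)⁻¹ := by positivity
    linarith
  · -- The span is the whole space: some eigenvalue of the source state is at most `1 / dim`.
    obtain ⟨U, hU, hρU, -⟩ := exists_spectralMatrix hρ.1.1
    have hq : ∀ a, 0 ≤ hρ.1.1.eigenvalues a := hρ.1.eigenvalues_nonneg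
    generalize hρ.1.1.eigenvalues = q at hρU hq
    have hqs : ∑ a, q a = 1 := by
      rw [← spectralMatrix_trace hU, ← hρU, hρ.2, Complex.one_re]
    obtain ⟨k, -, hk⟩ : ∃ k ∈ (Finset.univ : Finset D), q k ≤ (Fintype.card D : ℝ)⁻¹ := by
      refine Finset.exists_le_of_sum_le Finset.univ_nonempty (le_of_eq ?_)
      rw [hqs, Finset.sum_const, Finset.card_univ, nsmul_eq_mul, mul_inv_cancel₀ hcard.ne']
    obtain ⟨M', hM', V', hV', hfix'⟩ := exists_isometry ((Finset.univ.erase k).image Uᵀ)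
    have hlt : M' < Fintype.card D := by
      refine (hM'.trans Finset.card_image_le).trans_lt ?_
      rw [Finset.card_erase_of_mem (Finset.mem_univ k), Finset.card_univ]
      exact Nat.sub_lt Fintype.card_pos one_pos
    have hfix'' : ∀ a ∈ Finset.univ.erase k, (V' * V'ᴴ) *ᵥ Uᵀ a = Uᵀ a := fun a ha =>
      hfix' _ (Finset.mem_image_of_mem _ ha)
    obtain ⟨l, hl⟩ := exists_ne k
    have hM0 : NeZero M' := neZero_of_fixes hU (hfix'' l (by simp [hl]))
    refine ⟨isometryCode E hlt V' hV', (hlt.le.trans (not_lt.mp hM)).trans hMle',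
      Nat.pos_of_ne_zero hM0.out, ?_⟩
    refine le_trans ?_ (trace_le_avgFidelity_isometryCode hE hlt V' hV')
    have h1 := sum_le_trace_mul_spectralMatrix hU hq hfix''
    rw [← hρU, Finset.sum_erase_eq_sub (Finset.mem_univ k), hqs] at h1
    have h2 : ∑ a ∈ A, q₁ a ≤ 1 :=
      hs₁ ▸ Finset.sum_le_sum_of_subset_of_nonneg (Finset.subset_univ A) fun a _ _ => hq₁ a
    have h3 : ∑ a ∈ B, q₂ a ≤ 1 :=
      hs₂ ▸ Finset.sum_le_sum_of_subset_of_nonneg (Finset.subset_univ B) fun a _ _ => hq₂ a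
    have := mul_le_mul_of_nonneg_left h2 ht.1.le
    have := mul_le_mul_of_nonneg_left h3 (sub_nonneg.mpr ht.2.le)
    linarith

end DirectPart

/-! ### From limiting tails to the second order rate -/

section Rate

open scoped Topology

variable {d : Type*} [Fintype d]

/-- A state diagonalises with a probability distribution as its spectrum; its entropy and
information variance are those of the spectrum. -/
lemma IsState.exists_spectrum [DecidableEq d] {ρ : Matrix d d ℂ} (h : IsState ρ) :
    ∃ (U : Matrix d d ℂ) (p : d → ℝ), Uᴴ * U = 1 ∧ ρ = spectralMatrix U p ∧ (∀ a, 0 ≤ p a) ∧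
      ∑ a, p a = 1 ∧ entropy ρ = -∑ a, p a * Real.logb 2 (p a) ∧
      infoVariance ρ = ∑ a, p a * Real.logb 2 (p a) ^ 2 - entropy ρ ^ 2 := by
  obtain ⟨U, hU, hρ, hlog⟩ := exists_spectralMatrix h.1.1
  have hp : ∀ a, 0 ≤ h.1.1.eigenvalues a := h.1.eigenvalues_nonneg
  generalize h.1.1.eigenvalues = p at hρ hlog hp
  have h1 : (ρ * matLog ρ).trace.re = ∑ a, p a * Real.logb 2 (p a) := by
    rw [hlog, hρ, spectralMatrix_mul hU, spectralMatrix_trace hU]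
  have h2 : (ρ * matLog ρ ^ 2).trace.re = ∑ a, p a * Real.logb 2 (p a) ^ 2 := by
    rw [hlog, hρ, sq, spectralMatrix_mul hU, spectralMatrix_mul hU, spectralMatrix_trace hU]
    simp only [sq]
  refine ⟨U, p, hU, hρ, hp, ?_, by rw [entropy, h1], by rw [infoVariance, entropy, h2, neg_sq]⟩
  rw [← spectralMatrix_trace hU, ← hρ, h.2, Complex.one_re]

lemma tensorPower_isState [DecidableEq d] {U : Matrix d d ℂ} (hU : Uᴴ * U = 1) {p : d → ℝ}
    (h0 : ∀ a, 0 ≤ p a) (h1 : ∑ a, p a = 1) (n : ℕ) :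
    IsState (spectralMatrix (tensorPower U n) fun a => ∏ k, p (a k)) := by
  have hps : (spectralMatrix (tensorPower U n) fun a => ∏ k, p (a k)).PosSemidef :=
    spectralMatrix_posSemidef fun a => Finset.prod_nonneg fun k _ => h0 (a k)
  refine ⟨hps, Complex.ext ?_ ?_⟩
  · rw [spectralMatrix_trace (tensorPower_isometry hU n), sum_prod_eq_one h1, Complex.one_re]
  · exact (Complex.le_def.mp hps.trace_nonneg).2.symm

lemma IsState.mix [DecidableEq d] {ρ₁ ρ₂ : Matrix d d ℂ} (h₁ : IsState ρ₁) (h₂ : IsState ρ₂)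
    {t : ℝ} (ht : t ∈ Set.Ioo (0 : ℝ) 1) :
    IsState ((t : ℂ) • ρ₁ + ((1 - t : ℝ) : ℂ) • ρ₂) := by
  refine ⟨(h₁.1.smul (by exact_mod_cast ht.1.le)).add
    (h₂.1.smul (by exact_mod_cast sub_nonneg.mpr ht.2.le)), ?_⟩
  rw [trace_add, trace_smul, trace_smul, h₁.2, h₂.2]
  simp

lemma tendsto_sqrt_natCast : Tendsto (fun n : ℕ => √(n : ℝ)) atTop atTop :=
  Real.tendsto_sqrt_atTop.comp tendsto_natCast_atTop_atTop

section Limits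

variable {p : d → ℝ} {g : ℝ → ℝ} {S R : ℝ}

/-- Above the entropy rate the tail exhausts the distribution. -/
lemma tendsto_tailMass_one (h0 : ∀ a, 0 ≤ p a) (h1 : ∑ a, p a = 1)
    (hg : ∀ x, Tendsto (fun n : ℕ => tailMass p n (2 ^ (-(n * S + √n * x)))) atTop (𝓝 (g x)))
    (hg1 : Tendsto g atTop (𝓝 1)) (hR : S < R) (x : ℝ) :
    Tendsto (fun n : ℕ => tailMass p n (2 ^ (-(n * R + √n * x)))) atTop (𝓝 1) := by
  refine tendsto_order.mpr ⟨fun b hb => ?_, fun b hb =>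
    .of_forall fun n => (tailMass_le_one h0 h1 _ _).trans_lt hb⟩
  obtain ⟨y, hy⟩ := ((tendsto_order.mp hg1).1 b hb).exists
  have hbig := (tendsto_sqrt_natCast.atTop_mul_const (sub_pos.mpr hR)).eventually_ge_atTop (y - x)
  filter_upwards [(tendsto_order.mp (hg y)).1 b hy, hbig] with n hn hn'
  refine hn.trans_le (tailMass_anti h0 n ?_)
  refine Real.rpow_le_rpow_of_exponent_le (by norm_num) (neg_le_neg ?_)
  have h2 : √(n : ℝ) * √(n : ℝ) = n := Real.mul_self_sqrt (Nat.cast_nonneg n)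
  have h3 := mul_le_mul_of_nonneg_left hn' (Real.sqrt_nonneg (n : ℝ))
  nlinarith [h3, h2]

/-- Below the entropy rate the tail vanishes. -/
lemma tendsto_tailMass_zero (h0 : ∀ a, 0 ≤ p a)
    (hg : ∀ x, Tendsto (fun n : ℕ => tailMass p n (2 ^ (-(n * S + √n * x)))) atTop (𝓝 (g x)))
    (hg0 : Tendsto g atBot (𝓝 0)) (hR : R < S) (x : ℝ) :
    Tendsto (fun n : ℕ => tailMass p n (2 ^ (-(n * R + √n * x)))) atTop (𝓝 0) := by
  refine tendsto_order.mpr ⟨fun b hb =>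
    .of_forall fun n => hb.trans_le (tailMass_nonneg h0 _ _), fun b hb => ?_⟩
  obtain ⟨y, hy⟩ := ((tendsto_order.mp hg0).2 b hb).exists
  have hbig := (tendsto_sqrt_natCast.atTop_mul_const (sub_pos.mpr hR)).eventually_ge_atTop (x - y)
  filter_upwards [(tendsto_order.mp (hg y)).2 b hy, hbig] with n hn hn'
  refine (tailMass_anti h0 n ?_).trans_lt hn
  refine Real.rpow_le_rpow_of_exponent_le (by norm_num) (neg_le_neg ?_)
  have h2 : √(n : ℝ) * √(n : ℝ) = n := Real.mul_self_sqrt (Nat.cast_nonneg n)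
  have h3 := mul_le_mul_of_nonneg_left hn' (Real.sqrt_nonneg (n : ℝ))
  nlinarith [h3, h2]

end Limits

variable [DecidableEq d] {ι₁ ι₂ : Type*} {t : ℝ} {ht : t ∈ Set.Ioo (0 : ℝ) 1}
  {E₁ : PureEnsemble ι₁ d} {E₂ : PureEnsemble ι₂ d}
  {U₁ U₂ : Matrix d d ℂ} {p₁ p₂ : d → ℝ} {g₁ g₂ : ℝ → ℝ} {R ε r x : ℝ}

/-- Every `r` at which the limiting tails exceed `1 - ε` is achievable. -/
theorem isAchievableRate_of_lt [Nontrivial d]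
    (hU₁ : U₁ᴴ * U₁ = 1) (hU₂ : U₂ᴴ * U₂ = 1)
    (hE₁ : E₁.HasSourceState (spectralMatrix U₁ p₁)) (hE₂ : E₂.HasSourceState (spectralMatrix U₂ p₂))
    (hp₁ : ∀ a, 0 ≤ p₁ a) (hp₂ : ∀ a, 0 ≤ p₂ a) (hs₁ : ∑ a, p₁ a = 1) (hs₂ : ∑ a, p₂ a = 1)
    (hg₁ : ∀ x, Tendsto (fun n : ℕ => tailMass p₁ n (2 ^ (-(n * R + √n * x)))) atTop (𝓝 (g₁ x)))
    (hg₂ : ∀ x, Tendsto (fun n : ℕ => tailMass p₂ n (2 ^ (-(n * R + √n * x)))) atTop (𝓝 (g₂ x)))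
    (hr : 1 - ε < t * g₁ r + (1 - t) * g₂ r) (hR : 0 < R ∨ R = 0 ∧ 0 ≤ r) :
    IsAchievableRate t ht E₁ E₂ R ε r := by
  have hcode : ∀ n : ℕ+, ∃ C : VisibleCode ((Fin n → ι₁) ⊕ (Fin n → ι₂)) (Fin n → d),
      (C.M : ℝ) * 2 ^ (-(((n : ℕ) : ℝ) * R + √((n : ℕ) : ℝ) * r))
          ≤ 2 + 2 ^ (-(((n : ℕ) : ℝ) * R + √((n : ℕ) : ℝ) * r)) ∧ 0 < C.M ∧
      t * tailMass p₁ n (2 ^ (-(((n : ℕ) : ℝ) * R + √((n : ℕ) : ℝ) * r))) +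
        (1 - t) * tailMass p₂ n (2 ^ (-(((n : ℕ) : ℝ) * R + √((n : ℕ) : ℝ) * r)))
        - ((Fintype.card d : ℝ)⁻¹) ^ (n : ℕ)
        ≤ avgFidelity (PureEnsemble.mix t ht (E₁.power n) (E₂.power n)) C := by
    intro n
    have : Nonempty (Fin n) := ⟨⟨0, n.pos⟩⟩
    generalize hs : (2 : ℝ) ^ (-(((n : ℕ) : ℝ) * R + √((n : ℕ) : ℝ) * r)) = s
    have hs0 : 0 < s := hs ▸ Real.rpow_pos_of_pos (by norm_num) _
    have h1 := hE₁.power n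
    have h2 := hE₂.power n
    rw [tensorPower_spectralMatrix] at h1 h2
    obtain ⟨C, hCM, hC0, hC⟩ := exists_code (PureEnsemble.HasSourceState.mix ht h1 h2)
      (IsState.mix (tensorPower_isState hU₁ hp₁ hs₁ n) (tensorPower_isState hU₂ hp₂ hs₂ n) ht) ht
      (tensorPower_isometry hU₁ n) (tensorPower_isometry hU₂ n)
      (fun a => Finset.prod_nonneg fun k _ => hp₁ (a k))
      (fun a => Finset.prod_nonneg fun k _ => hp₂ (a k))
      (sum_prod_eq_one hs₁ n) (sum_prod_eq_one hs₂ n) rfl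
      {a | s ≤ ∏ k, p₁ (a k)} {a | s ≤ ∏ k, p₂ (a k)}
    refine ⟨C, ?_, hC0, ?_⟩
    · have hA := card_mul_le_one hp₁ hs₁ n s
      have hB := card_mul_le_one hp₂ hs₂ n s
      have hCM' : (C.M : ℝ) ≤ (Finset.card {a : Fin n → d | s ≤ ∏ k, p₁ (a k)} : ℝ)
        + (Finset.card {a : Fin n → d | s ≤ ∏ k, p₂ (a k)} : ℝ) + 1 := by exact_mod_cast hCM
      have := mul_le_mul_of_nonneg_right hCM' hs0.le
      linarith
    · refine le_trans (le_of_eq ?_) hC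
      simp [tailMass]
  choose C hCM hC0 hC using hcode
  refine ⟨C, ?_, ?_⟩
  · refine le_liminf_of_le (h := ?_)
    have hd : (1 : ℝ) < Fintype.card d := by exact_mod_cast Fintype.one_lt_card
    have hpow : Tendsto (fun n : ℕ => ((Fintype.card d : ℝ)⁻¹) ^ n) atTop (𝓝 0) :=
      tendsto_pow_atTop_nhds_zero_of_lt_one (by positivity) (inv_lt_one_of_one_lt₀ hd)
    have hlim := (((hg₁ r).const_mul t).add ((hg₂ r).const_mul (1 - t))).sub hpow
    rw [sub_zero] at hlim
    have hev := tendsto_PNat_val_atTop_atTop.eventually ((tendsto_order.mp hlim).1 _ hr)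
    filter_upwards [hev] with n hn
    exact EReal.coe_le_coe_iff.mpr (hn.le.trans (hC n))
  · have hnn : ∀ᶠ n : ℕ in atTop, 0 ≤ n * R + √(n : ℝ) * r := by
      rcases hR with hR | ⟨hR, hr0⟩
      · filter_upwards [(tendsto_sqrt_natCast.atTop_mul_const hR).eventually_ge_atTop (-r)]
          with n hn
        have h2 : √(n : ℝ) * √(n : ℝ) = n := Real.mul_self_sqrt (Nat.cast_nonneg n)
        have h3 := mul_le_mul_of_nonneg_left hn (Real.sqrt_nonneg (n : ℝ))
        nlinarith [h2, h3]
      · filter_upwards with n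
        rw [hR, mul_zero, zero_add]
        exact mul_nonneg (Real.sqrt_nonneg _) hr0
    have hlim : Tendsto (fun n : ℕ => r + Real.logb 2 3 / √(n : ℝ)) atTop (𝓝 r) := by
      simpa using tendsto_const_nhds.add (tendsto_sqrt_natCast.const_div_atTop (Real.logb 2 3))
    have hlim' := (continuous_coe_real_ereal.tendsto r).comp
      (hlim.comp tendsto_PNat_val_atTop_atTop)
    rw [← hlim'.limsup_eq]
    refine limsup_le_limsup ?_
    filter_upwards [tendsto_PNat_val_atTop_atTop.eventually hnn] with n hn
    refine EReal.coe_le_coe_iff.mpr ?_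
    change (Real.logb 2 (C n).M - (n : ℕ) * R) / √((n : ℕ) : ℝ)
      ≤ r + Real.logb 2 3 / √((n : ℕ) : ℝ)
    have hsq : 0 < √((n : ℕ) : ℝ) := Real.sqrt_pos.mpr (by exact_mod_cast n.pos)
    have hM0 : (0 : ℝ) < (C n).M := by exact_mod_cast hC0 n
    have hs1 : (2 : ℝ) ^ (-(((n : ℕ) : ℝ) * R + √((n : ℕ) : ℝ) * r)) ≤ 1 :=
      Real.rpow_le_one_of_one_le_of_nonpos (by norm_num) (by linarith)
    have hs0 : (0 : ℝ) < 2 ^ (-(((n : ℕ) : ℝ) * R + √((n : ℕ) : ℝ) * r)) :=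
      Real.rpow_pos_of_pos (by norm_num) _
    have hle : ((C n).M : ℝ) * 2 ^ (-(((n : ℕ) : ℝ) * R + √((n : ℕ) : ℝ) * r)) ≤ 3 :=
      (hCM n).trans (by linarith)
    have hlog := Real.logb_le_logb_of_le (b := 2) (by norm_num) (mul_pos hM0 hs0) hle
    rw [Real.logb_mul hM0.ne' hs0.ne', Real.logb_rpow (by norm_num) (by norm_num)] at hlog
    rw [div_le_iff₀ hsq, add_mul, div_mul_cancel₀ _ hsq.ne']
    linarith

/-- No `r` below a point at which the limiting tails are less than `1 - ε` is achievable. -/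
theorem not_isAchievableRate_of_lt
    (hU₁ : U₁ᴴ * U₁ = 1) (hU₂ : U₂ᴴ * U₂ = 1)
    (hE₁ : E₁.HasSourceState (spectralMatrix U₁ p₁)) (hE₂ : E₂.HasSourceState (spectralMatrix U₂ p₂))
    (hp₁ : ∀ a, 0 ≤ p₁ a) (hp₂ : ∀ a, 0 ≤ p₂ a) (hs₁ : ∑ a, p₁ a = 1) (hs₂ : ∑ a, p₂ a = 1)
    (hg₁ : ∀ x, Tendsto (fun n : ℕ => tailMass p₁ n (2 ^ (-(n * R + √n * x)))) atTop (𝓝 (g₁ x)))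
    (hg₂ : ∀ x, Tendsto (fun n : ℕ => tailMass p₂ n (2 ^ (-(n * R + √n * x)))) atTop (𝓝 (g₂ x)))
    (hx : t * g₁ x + (1 - t) * g₂ x < 1 - ε) (hr : r < x) :
    ¬ IsAchievableRate t ht E₁ E₂ R ε r := by
  rintro ⟨C, hF, hM⟩
  set f := t * g₁ x + (1 - t) * g₂ x with hf
  have hf1 : f ≤ 1 := by
    have h1 : g₁ x ≤ 1 := le_of_tendsto (hg₁ x) (.of_forall fun n => tailMass_le_one hp₁ hs₁ _ _)
    have h2 : g₂ x ≤ 1 := le_of_tendsto (hg₂ x) (.of_forall fun n => tailMass_le_one hp₂ hs₂ _ _)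
    have := mul_le_mul_of_nonneg_left h1 ht.1.le
    have := mul_le_mul_of_nonneg_left h2 (sub_nonneg.mpr ht.2.le)
    linarith
  -- The constant of the converse bound, small enough that `(1 + c) f` stays below `1 - ε`.
  let c := (1 - ε - f) / 2
  have hc : 0 < c := by simp only [c]; linarith
  have hcf : (1 + c) * f < 1 - ε := by
    have : c * f ≤ c * 1 := mul_le_mul_of_nonneg_left hf1 hc.le
    have : c < 1 - ε - f := by simp only [c]; linarith
    linarith
  obtain ⟨y, hry, hyx⟩ := exists_between hr
  have hMev := eventually_lt_of_limsup_lt (hM.trans_lt (EReal.coe_lt_coe_iff.mpr hry))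
  have hbound : ∀ᶠ n : ℕ+ in atTop,
      avgFidelity (PureEnsemble.mix t ht (E₁.power n) (E₂.power n)) (C n)
        ≤ (1 + c) * (t * tailMass p₁ n (2 ^ (-(((n : ℕ) : ℝ) * R + √((n : ℕ) : ℝ) * x)))
          + (1 - t) * tailMass p₂ n (2 ^ (-(((n : ℕ) : ℝ) * R + √((n : ℕ) : ℝ) * x))))
          + (1 + c⁻¹) * 2 ^ (-(√((n : ℕ) : ℝ) * (x - y))) := by
    filter_upwards [hMev] with n hn
    have hn' : (Real.logb 2 (C n).M - (n : ℕ) * R) / √((n : ℕ) : ℝ) < y :=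
      EReal.coe_lt_coe_iff.mp hn
    have hsq : 0 < √((n : ℕ) : ℝ) := Real.sqrt_pos.mpr (by exact_mod_cast n.pos)
    rw [div_lt_iff₀ hsq] at hn'
    have hMle : ((C n).M : ℝ) ≤ 2 ^ (((n : ℕ) : ℝ) * R + √((n : ℕ) : ℝ) * y) := by
      rcases Nat.eq_zero_or_pos (C n).M with h | h
      · rw [h, Nat.cast_zero]; positivity
      · rw [← Real.logb_le_iff_le_rpow (by norm_num) (by exact_mod_cast h)]
        linarith
    have hsM : (2 : ℝ) ^ (-(((n : ℕ) : ℝ) * R + √((n : ℕ) : ℝ) * x)) * (C n).M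
        ≤ 2 ^ (-(√((n : ℕ) : ℝ) * (x - y))) := by
      refine (mul_le_mul_of_nonneg_left hMle (by positivity)).trans (le_of_eq ?_)
      rw [← Real.rpow_add (by norm_num)]
      congr 1; ring
    have h1 := hE₁.power n
    have h2 := hE₂.power n
    rw [tensorPower_spectralMatrix] at h1 h2
    have hs0 : (0 : ℝ) ≤ 2 ^ (-(((n : ℕ) : ℝ) * R + √((n : ℕ) : ℝ) * x)) := by positivity
    have hF₁ := avgFidelity_le h1 (tensorPower_isometry hU₁ n) ((C n).comap Sum.inl) hs0 hc
    have hF₂ := avgFidelity_le h2 (tensorPower_isometry hU₂ n) ((C n).comap Sum.inr) hs0 hc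
    have hsM' := mul_le_mul_of_nonneg_left hsM (by positivity : 0 ≤ 1 + c⁻¹)
    have hF₁' := mul_le_mul_of_nonneg_left (hF₁.trans (add_le_add le_rfl hsM')) ht.1.le
    have hF₂' := mul_le_mul_of_nonneg_left (hF₂.trans (add_le_add le_rfl hsM'))
      (sub_nonneg.mpr ht.2.le)
    rw [avgFidelity_mix]
    refine (add_le_add hF₁' hF₂').trans (le_of_eq ?_)
    simp only [tailMass]
    ring
  have hsmall : Tendsto (fun n : ℕ => (2 : ℝ) ^ (-(√(n : ℝ) * (x - y)))) atTop (𝓝 0) := by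
    have h := tendsto_sqrt_natCast.atTop_mul_const (sub_pos.mpr hyx)
    exact (tendsto_rpow_atBot_of_base_gt_one 2 (by norm_num)).comp (tendsto_neg_atTop_atBot.comp h)
  have hlim := ((((hg₁ x).const_mul t).add ((hg₂ x).const_mul (1 - t))).const_mul (1 + c)).add
    (hsmall.const_mul (1 + c⁻¹))
  rw [mul_zero, add_zero, ← hf] at hlim
  have hlim' := (continuous_coe_real_ereal.tendsto _).comp (hlim.comp tendsto_PNat_val_atTop_atTop)
  have hle := liminf_le_liminf (hbound.mono fun n hn => EReal.coe_le_coe_iff.mpr hn)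
  have := (hF.trans hle).trans (le_of_eq hlim'.liminf_eq)
  exact absurd (EReal.coe_le_coe_iff.mp this) (not_le.mpr hcf)

/-- The second order rate is the point at which the limiting tails of the mixture cross
`1 - ε`. -/
theorem secondOrderRate_eq [Nontrivial d] {L : ℝ}
    (hU₁ : U₁ᴴ * U₁ = 1) (hU₂ : U₂ᴴ * U₂ = 1)
    (hE₁ : E₁.HasSourceState (spectralMatrix U₁ p₁)) (hE₂ : E₂.HasSourceState (spectralMatrix U₂ p₂))
    (hp₁ : ∀ a, 0 ≤ p₁ a) (hp₂ : ∀ a, 0 ≤ p₂ a) (hs₁ : ∑ a, p₁ a = 1) (hs₂ : ∑ a, p₂ a = 1)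
    (hg₁ : ∀ x, Tendsto (fun n : ℕ => tailMass p₁ n (2 ^ (-(n * R + √n * x)))) atTop (𝓝 (g₁ x)))
    (hg₂ : ∀ x, Tendsto (fun n : ℕ => tailMass p₂ n (2 ^ (-(n * R + √n * x)))) atTop (𝓝 (g₂ x)))
    (hlt : ∀ x < L, t * g₁ x + (1 - t) * g₂ x < 1 - ε)
    (hgt : ∀ x, L < x → 1 - ε < t * g₁ x + (1 - t) * g₂ x) (hR : 0 < R ∨ R = 0 ∧ 0 ≤ L) :
    secondOrderRate t ht E₁ E₂ R ε = L := by
  refine le_antisymm (EReal.le_of_forall_lt_iff_le.mp fun r hr => iInf₂_le r ?_)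
    (le_iInf₂ fun r hr => EReal.coe_le_coe_iff.mpr (not_lt.mp fun hrL => ?_))
  · have hr' := EReal.coe_lt_coe_iff.mp hr
    exact isAchievableRate_of_lt hU₁ hU₂ hE₁ hE₂ hp₁ hp₂ hs₁ hs₂ hg₁ hg₂ (hgt r hr')
      (hR.imp_right fun h => ⟨h.1, h.2.trans hr'.le⟩)
  · obtain ⟨x, hrx, hxL⟩ := exists_between hrL
    exact not_isAchievableRate_of_lt hU₁ hU₂ hE₁ hE₂ hp₁ hp₂ hs₁ hs₂ hg₁ hg₂ (hlt x hxL) hrx hr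

end Rate

/-! ### The normal distribution function -/

section Normal

open MeasureTheory ProbabilityTheory
open scoped Topology

lemma Phi_strictMono : StrictMono Phi := by
  intro a b hab
  have hne : (gaussianReal 0 1) (Set.Ioc a b) ≠ 0 := fun h => by
    have := gaussianReal_absolutelyContinuous' 0 one_ne_zero h
    rw [Real.volume_Ioc, ENNReal.ofReal_eq_zero] at this
    linarith
  have hpos : 0 < (gaussianReal 0 1).real (Set.Ioc a b) :=
    ENNReal.toReal_pos hne (measure_ne_top _ _)
  rw [Phi_eq, Phi_eq, ← Set.Iic_union_Ioc_eq_Iic hab.le,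
    measureReal_union (Set.Iic_disjoint_Ioc le_rfl) measurableSet_Ioc]
  linarith

lemma Phi_neg (x : ℝ) : Phi (-x) = 1 - Phi x := by
  have hatom := nullSingletonClass_gaussianReal (μ := 0) (v := 1) one_ne_zero
  have h : (gaussianReal 0 1).map (fun y => -y) = gaussianReal 0 1 := by
    rw [gaussianReal_map_neg, neg_zero]
  rw [Phi_eq, Phi_eq, ← probReal_compl_eq_one_sub measurableSet_Iic, ← h,
    map_measureReal_apply (by fun_prop) measurableSet_Iic, h, Set.compl_Iic]
  have : (fun y : ℝ => -y) ⁻¹' Set.Iic (-x) = Set.Ici x := by ext y; simp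
  rw [this, measureReal_def, measureReal_def, measure_congr Ioi_ae_eq_Ici]

lemma Phi_continuous : Continuous Phi := by
  have hatom := nullSingletonClass_gaussianReal (μ := 0) (v := 1) one_ne_zero
  change Continuous (cdf (gaussianReal 0 1))
  refine continuous_iff_continuousAt.mpr fun x => ?_
  rw [(cdf (gaussianReal 0 1)).mono.continuousAt_iff_leftLim_eq_rightLim,
    StieltjesFunction.rightLim_eq]
  have h := (cdf (gaussianReal 0 1)).measure_singleton x
  rw [measure_cdf, measure_singleton, eq_comm, ENNReal.ofReal_eq_zero, sub_nonpos] at h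
  exact le_antisymm ((cdf (gaussianReal 0 1)).mono.leftLim_le le_rfl) h

lemma Phi_tendsto_atTop : Tendsto Phi atTop (𝓝 1) := tendsto_cdf_atTop _

lemma Phi_tendsto_atBot : Tendsto Phi atBot (𝓝 0) := tendsto_cdf_atBot _

lemma bddAbove_setOf_Phi_le {u : ℝ} (hu : u < 1) : BddAbove {z : ℝ | Phi z ≤ u} := by
  obtain ⟨b, hb⟩ := ((tendsto_order.mp Phi_tendsto_atTop).1 u hu).exists
  exact ⟨b, fun z hz => (Phi_strictMono.lt_iff_lt.mp (lt_of_le_of_lt hz hb)).le⟩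

lemma nonempty_setOf_Phi_le {u : ℝ} (hu : 0 < u) : {z : ℝ | Phi z ≤ u}.Nonempty := by
  obtain ⟨b, hb⟩ := ((tendsto_order.mp Phi_tendsto_atBot).2 u hu).exists
  exact ⟨b, hb.le⟩

lemma lt_Phi_of_PhiInv_lt {u z : ℝ} (hu : u < 1) (h : PhiInv u < z) : u < Phi z :=
  not_le.mp fun hz => absurd (le_csSup (bddAbove_setOf_Phi_le hu) hz) (not_le.mpr h)

lemma Phi_lt_of_lt_PhiInv {u z : ℝ} (hu : 0 < u) (h : z < PhiInv u) : Phi z < u := by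
  obtain ⟨w, hw, hzw⟩ := exists_lt_of_lt_csSup (nonempty_setOf_Phi_le hu) h
  exact (Phi_strictMono hzw).trans_le hw

lemma scaledPhi_lt_of_lt {σ u x : ℝ} (hσ : 0 ≤ σ) (hu : u < 1) (h : x < -σ * PhiInv u) :
    scaledPhi σ x < 1 - u := by
  unfold scaledPhi
  split_ifs with h0 hx
  · linarith
  · rw [h0, neg_zero, zero_mul] at h
    exact absurd h hx
  · have hpos : 0 < σ := lt_of_le_of_ne hσ (Ne.symm h0)
    have := lt_Phi_of_PhiInv_lt (z := -(x / σ)) hu (by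
      rw [← neg_div, lt_div_iff₀ hpos]; linarith)
    rw [Phi_neg] at this
    linarith

lemma lt_scaledPhi_of_lt {σ u x : ℝ} (hσ : 0 ≤ σ) (hu : 0 < u) (h : -σ * PhiInv u < x) :
    1 - u < scaledPhi σ x := by
  unfold scaledPhi
  split_ifs with h0 hx
  · rw [h0, neg_zero, zero_mul] at h
    exact absurd h (not_lt.mpr hx.le)
  · linarith
  · have hpos : 0 < σ := lt_of_le_of_ne hσ (Ne.symm h0)
    have := Phi_lt_of_lt_PhiInv (z := -(x / σ)) hu (by
      rw [← neg_div, div_lt_iff₀ hpos]; linarith)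
    rw [Phi_neg] at this
    linarith

lemma scaledPhi_strictMono {σ : ℝ} (hσ : 0 < σ) : StrictMono (scaledPhi σ) := by
  intro x y hxy
  simp only [scaledPhi, if_neg hσ.ne']
  exact Phi_strictMono (div_lt_div_of_pos_right hxy hσ)

lemma scaledPhi_monotone {σ : ℝ} (hσ : 0 ≤ σ) : Monotone (scaledPhi σ) := by
  rcases hσ.eq_or_lt with rfl | hσ
  · intro x y hxy
    simp only [scaledPhi, if_true]
    split_ifs <;> linarith
  · exact (scaledPhi_strictMono hσ).monotone

lemma scaledPhi_tendsto_atTop {σ : ℝ} (hσ : 0 ≤ σ) : Tendsto (scaledPhi σ) atTop (𝓝 1) := by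
  rcases hσ.eq_or_lt with rfl | hσ
  · refine tendsto_const_nhds.congr' ?_
    filter_upwards [eventually_ge_atTop 0] with x hx
    simp [scaledPhi, not_lt.mpr hx]
  · have : scaledPhi σ = fun x => Phi (x / σ) := by ext x; simp [scaledPhi, hσ.ne']
    rw [this]
    exact Phi_tendsto_atTop.comp (tendsto_id.atTop_div_const hσ)

lemma scaledPhi_tendsto_atBot {σ : ℝ} (hσ : 0 ≤ σ) : Tendsto (scaledPhi σ) atBot (𝓝 0) := by
  rcases hσ.eq_or_lt with rfl | hσ
  · refine tendsto_const_nhds.congr' ?_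
    filter_upwards [eventually_lt_atBot 0] with x hx
    simp [scaledPhi, hx]
  · have : scaledPhi σ = fun x => Phi (x / σ) := by ext x; simp [scaledPhi, hσ.ne']
    rw [this]
    exact Phi_tendsto_atBot.comp (tendsto_id.atBot_div_const hσ)

/-- The mixture of two centred normal distribution functions crosses every level in `(0, 1)` at
exactly one point, also when one or both are degenerate. -/
lemma exists_crossing {t σ₁ σ₂ u : ℝ} (ht : t ∈ Set.Ioo (0 : ℝ) 1) (hσ₁ : 0 ≤ σ₁) (hσ₂ : 0 ≤ σ₂)
    (hu : u ∈ Set.Ioo (0 : ℝ) 1) :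
    ∃ L : ℝ, (∀ x < L, t * scaledPhi σ₁ x + (1 - t) * scaledPhi σ₂ x < u) ∧
      ∀ x, L < x → u < t * scaledPhi σ₁ x + (1 - t) * scaledPhi σ₂ x := by
  have ht' : 0 < 1 - t := sub_pos.mpr ht.2
  by_cases h0 : σ₁ = 0 ∧ σ₂ = 0
  · refine ⟨0, fun x hx => ?_, fun x hx => ?_⟩
    · simp [scaledPhi, h0, hx, hu.1]
    · simp [scaledPhi, h0, not_lt.mpr hx.le, hu.2]
  set f : ℝ → ℝ := fun x => t * scaledPhi σ₁ x + (1 - t) * scaledPhi σ₂ x with hf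
  have hmono : StrictMono f := by
    intro x y hxy
    have m₁ := scaledPhi_monotone hσ₁ hxy.le
    have m₂ := scaledPhi_monotone hσ₂ hxy.le
    rcases not_and_or.mp h0 with h | h
    · have := scaledPhi_strictMono (lt_of_le_of_ne hσ₁ (Ne.symm h)) hxy
      exact add_lt_add_of_lt_of_le (mul_lt_mul_of_pos_left this ht.1)
        (mul_le_mul_of_nonneg_left m₂ ht'.le)
    · have := scaledPhi_strictMono (lt_of_le_of_ne hσ₂ (Ne.symm h)) hxy
      exact add_lt_add_of_le_of_lt (mul_le_mul_of_nonneg_left m₁ ht.1.le)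
        (mul_lt_mul_of_pos_left this ht')
  have htop : Tendsto f atTop (𝓝 1) := by
    have := ((scaledPhi_tendsto_atTop hσ₁).const_mul t).add
      ((scaledPhi_tendsto_atTop hσ₂).const_mul (1 - t))
    simpa using this
  have hbot : Tendsto f atBot (𝓝 0) := by
    have := ((scaledPhi_tendsto_atBot hσ₁).const_mul t).add
      ((scaledPhi_tendsto_atBot hσ₂).const_mul (1 - t))
    simpa using this
  obtain ⟨b, hb⟩ := ((tendsto_order.mp htop).1 u hu.2).exists
  obtain ⟨a, ha⟩ := ((tendsto_order.mp hbot).2 u hu.1).exists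
  have hbdd : BddBelow {x | u ≤ f x} :=
    ⟨a, fun x hx => (hmono.lt_iff_lt.mp (lt_of_lt_of_le ha hx)).le⟩
  refine ⟨sInf {x | u ≤ f x}, fun x hx => not_le.mp fun h => ?_, fun x hx => ?_⟩
  · exact absurd (csInf_le hbdd h) (not_le.mpr hx)
  · obtain ⟨y, hy, hyx⟩ := exists_lt_of_csInf_lt ⟨b, hb.le⟩ hx
    exact lt_of_le_of_lt hy (hmono hyx)

/-- A crossing point of a continuous mixture is the unique solution of the equation. -/
lemma eq_iff_of_crossing {t σ₁ σ₂ u L : ℝ} (hσ₁ : 0 < σ₁) (hσ₂ : 0 < σ₂)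
    (hlt : ∀ x < L, t * scaledPhi σ₁ x + (1 - t) * scaledPhi σ₂ x < u)
    (hgt : ∀ x, L < x → u < t * scaledPhi σ₁ x + (1 - t) * scaledPhi σ₂ x) (x : ℝ) :
    t * Phi (x / σ₁) + (1 - t) * Phi (x / σ₂) = u ↔ x = L := by
  simp only [scaledPhi, if_neg hσ₁.ne', if_neg hσ₂.ne'] at hlt hgt
  have hcont : Continuous fun x => t * Phi (x / σ₁) + (1 - t) * Phi (x / σ₂) := by
    have := Phi_continuous
    fun_prop
  constructor
  · intro h
    rcases lt_trichotomy x L with hx | hx | hx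
    · exact absurd h (hlt x hx).ne
    · exact hx
    · exact absurd h (hgt x hx).ne'
  · rintro rfl
    refine le_antisymm ?_ ?_
    · exact le_of_tendsto (hcont.continuousWithinAt (s := Set.Iio x) (x := x))
        (eventually_nhdsWithin_of_forall fun y hy => (hlt y hy).le)
    · exact ge_of_tendsto (hcont.continuousWithinAt (s := Set.Ioi x) (x := x))
        (eventually_nhdsWithin_of_forall fun y hy => (hgt y hy).le)

end Normal

/-! ### The rate of the mixed source -/

section Entropy

variable {d : Type*} [Fintype d] {p : d → ℝ}

lemma mul_logb_nonpos (h0 : ∀ a, 0 ≤ p a) (h1 : ∑ a, p a = 1) (a : d) :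
    p a * Real.logb 2 (p a) ≤ 0 := by
  have hle : p a ≤ 1 := h1 ▸ Finset.single_le_sum (fun b _ => h0 b) (Finset.mem_univ a)
  exact mul_nonpos_of_nonneg_of_nonpos (h0 a) (Real.logb_nonpos (by norm_num) (h0 a) hle)

lemma entropy_nonneg [DecidableEq d] {ρ : Matrix d d ℂ} (h : IsState ρ) : 0 ≤ entropy ρ := by
  obtain ⟨U, p, -, -, h0, h1, hS, -⟩ := h.exists_spectrum
  rw [hS]
  exact neg_nonneg.mpr (Finset.sum_nonpos fun a _ => mul_logb_nonpos h0 h1 a)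

lemma sigma_eq_zero_of_entropy_eq_zero [DecidableEq d] {ρ : Matrix d d ℂ} (h : IsState ρ)
    (h0 : entropy ρ = 0) : sigma ρ = 0 := by
  obtain ⟨U, p, -, -, hp, h1, hS, hV⟩ := h.exists_spectrum
  rw [h0, eq_comm, neg_eq_zero, Finset.sum_eq_zero_iff_of_nonpos
    fun a _ => mul_logb_nonpos hp h1 a] at hS
  have : ∑ a, p a * Real.logb 2 (p a) ^ 2 = 0 := Finset.sum_eq_zero fun a ha => by
    rw [sq, ← mul_assoc, hS a ha, zero_mul]
  rw [sigma, hV, this, h0]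
  simp

end Entropy

end

end MixedSource

theorem theorem2 {ι₁ ι₂ d : Type*} [Fintype d] [DecidableEq d] [Nontrivial d]
    (t : ℝ) (ht : t ∈ Set.Ioo (0 : ℝ) 1) (ε : ℝ) (hε : ε ∈ Set.Ioo (0 : ℝ) 1)
    (ρ₁ ρ₂ : Matrix d d ℂ)
    (hρ₁ : MixedSource.IsState ρ₁) (hρ₂ : MixedSource.IsState ρ₂)
    (E₁ : MixedSource.PureEnsemble ι₁ d) (E₂ : MixedSource.PureEnsemble ι₂ d)
    (hE₁ : E₁.HasSourceState ρ₁) (hE₂ : E₂.HasSourceState ρ₂)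
    (S₁ S₂ σ₁ σ₂ : ℝ)
    (hS₁ : S₁ = MixedSource.entropy ρ₁) (hS₂ : S₂ = MixedSource.entropy ρ₂)
    (hσ₁ : σ₁ = MixedSource.sigma ρ₁) (hσ₂ : σ₂ = MixedSource.sigma ρ₂) :
    -- (i) equal entropies: the rate is the point `L` where the left-hand side of the equation
    -- crosses `1 - ε`, and the unique solution of the equation if `σ₁` and `σ₂` are positive
    (∀ S : ℝ, S₁ = S → S₂ = S →
      ∃ L : ℝ, MixedSource.secondOrderRate t ht E₁ E₂ S ε = (L : EReal) ∧
        (∀ x : ℝ, x < L →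
          t * MixedSource.scaledPhi σ₁ x + (1 - t) * MixedSource.scaledPhi σ₂ x < 1 - ε) ∧
        (∀ x : ℝ, L < x →
          1 - ε < t * MixedSource.scaledPhi σ₁ x + (1 - t) * MixedSource.scaledPhi σ₂ x) ∧
        (0 < σ₁ → 0 < σ₂ → ∀ x : ℝ,
          t * MixedSource.Phi (x / σ₁) + (1 - t) * MixedSource.Phi (x / σ₂) = 1 - ε ↔ x = L)) ∧
    -- (ii)
    (S₂ < S₁ → ε < t →
      MixedSource.secondOrderRate t ht E₁ E₂ S₁ ε =
        ((-σ₁ * MixedSource.PhiInv (ε / t) : ℝ) : EReal)) ∧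
    -- (iii)
    (S₂ < S₁ → t < ε →
      MixedSource.secondOrderRate t ht E₁ E₂ S₂ ε =
        ((-σ₂ * MixedSource.PhiInv ((ε - t) / (1 - t)) : ℝ) : EReal)) := by
  obtain ⟨U₁, p₁, hU₁, hρU₁, hp₁, hs₁, hH₁, hV₁⟩ := hρ₁.exists_spectrum
  obtain ⟨U₂, p₂, hU₂, hρU₂, hp₂, hs₂, hH₂, hV₂⟩ := hρ₂.exists_spectrum
  have hσ₁0 : 0 ≤ σ₁ := hσ₁ ▸ Real.sqrt_nonneg _
  have hσ₂0 : 0 ≤ σ₂ := hσ₂ ▸ Real.sqrt_nonneg _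
  have hS₂0 : 0 ≤ S₂ := hS₂ ▸ MixedSource.entropy_nonneg hρ₂
  have hg₁ := MixedSource.tendsto_tailMass hp₁ hs₁ hH₁ hV₁
  have hg₂ := MixedSource.tendsto_tailMass hp₂ hs₂ hH₂ hV₂
  simp only [← MixedSource.sigma.eq_1] at hg₁ hg₂
  rw [← hS₁, ← hσ₁] at hg₁
  rw [← hS₂, ← hσ₂] at hg₂
  have hE₁' := hE₁
  have hE₂' := hE₂
  rw [hρU₁] at hE₁'
  rw [hρU₂] at hE₂'
  refine ⟨fun S h₁ h₂ => ?_, fun hS ht' => ?_, fun hS ht' => ?_⟩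
  · subst h₁
    obtain ⟨L, hlt, hgt⟩ := MixedSource.exists_crossing ht hσ₁0 hσ₂0
      (u := 1 - ε) ⟨by linarith [hε.2], by linarith [hε.1]⟩
    refine ⟨L, ?_, hlt, hgt, fun h1 h2 => MixedSource.eq_iff_of_crossing h1 h2 hlt hgt⟩
    rw [h₂] at hg₂ hS₂0
    refine MixedSource.secondOrderRate_eq hU₁ hU₂ hE₁' hE₂' hp₁ hp₂ hs₁ hs₂ hg₁ hg₂ hlt hgt ?_
    rcases hS₂0.eq_or_lt with h | h
    · -- A source without entropy has `σ = 0`, and then the crossing point is `0`.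
      refine .inr ⟨h.symm, not_lt.mp fun hL => ?_⟩
      obtain ⟨x, hLx, hx⟩ := exists_between hL
      have hz₁ : σ₁ = 0 := by
        rw [hσ₁]; exact MixedSource.sigma_eq_zero_of_entropy_eq_zero hρ₁ (by rw [← hS₁, ← h])
      have hz₂ : σ₂ = 0 := by
        rw [hσ₂]; exact MixedSource.sigma_eq_zero_of_entropy_eq_zero hρ₂ (by rw [← hS₂, h₂, ← h])
      have := hgt x hLx
      simp only [MixedSource.scaledPhi, hz₁, hz₂, if_true, if_pos hx] at this
      linarith [hε.2]
    · exact .inl h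
  · have ht0 := ht.1
    have hu : t * (1 - ε / t) = t - ε := by field_simp
    refine MixedSource.secondOrderRate_eq hU₁ hU₂ hE₁' hE₂' hp₁ hp₂ hs₁ hs₂ hg₁
      (MixedSource.tendsto_tailMass_one hp₂ hs₂ hg₂ (MixedSource.scaledPhi_tendsto_atTop hσ₂0) hS)
      (fun x hx => ?_) (fun x hx => ?_) (.inl (hS₂0.trans_lt hS))
    · have := mul_lt_mul_of_pos_left
        (MixedSource.scaledPhi_lt_of_lt hσ₁0 ((div_lt_one ht0).mpr ht') hx) ht0
      linarith
    · have := mul_lt_mul_of_pos_left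
        (MixedSource.lt_scaledPhi_of_lt hσ₁0 (div_pos hε.1 ht0) hx) ht0
      linarith
  · have ht1 : 0 < 1 - t := sub_pos.mpr ht.2
    have hu : (1 - t) * (1 - (ε - t) / (1 - t)) = 1 - ε := by field_simp; ring
    have hu1 : (ε - t) / (1 - t) < 1 := (div_lt_one ht1).mpr (by linarith [hε.2])
    have hu0 : 0 < (ε - t) / (1 - t) := div_pos (sub_pos.mpr ht') ht1
    refine MixedSource.secondOrderRate_eq hU₁ hU₂ hE₁' hE₂' hp₁ hp₂ hs₁ hs₂
      (MixedSource.tendsto_tailMass_zero hp₁ hg₁ (MixedSource.scaledPhi_tendsto_atBot hσ₁0) hS) hg₂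
      (fun x hx => ?_) (fun x hx => ?_) ?_
    · have := mul_lt_mul_of_pos_left (MixedSource.scaledPhi_lt_of_lt hσ₂0 hu1 hx) ht1
      linarith
    · have := mul_lt_mul_of_pos_left (MixedSource.lt_scaledPhi_of_lt hσ₂0 hu0 hx) ht1
      linarith
    · rcases hS₂0.eq_or_lt with h | h
      · have hz₂ : σ₂ = 0 := by
          rw [hσ₂]; exact MixedSource.sigma_eq_zero_of_entropy_eq_zero hρ₂ (by rw [← hS₂, ← h])
        exact .inr ⟨h.symm, by rw [hz₂]; simp⟩
      · exact .inl h
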